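/- Let $n\in\mathbb N$ and $\hbar>0$. Write $\partial_z^R=\partial^{|R|}/\partial z^R$ and $\partial_{\bar z}^S=\partial^{|S|}/\partial\bar z^S$ for multi-indices $R,S\in\mathbb N^n$ (Wirtinger derivatives on $\mathbb C^n$), and $\bar w w'=\sum_i\bar w^i w'^i$. *The space $\mathfrak D$.* For a smooth function $f:\mathbb C^n\to\mathbb C$ define $h_{m,\ell,R,S}(f)\in[0,\infty]$, for $m\ge 0$, $0\le\ell<2^m$, recursively by $$h_{0,0,R,S}(f)=\sum_{N\in\mathbb N^n}\frac{(2\hbar)^{|R|+|S|+|N|}}{N!}\bigl|\partial_z^R\partial_{\bar z}^{N+S}f(0)\bigr|^2,$$ $$h_{m,\ell,R,S}(f)=\sum_{N\in\mathbb N^n}\frac1{N!}\Bigl(\sum_{I\le R}\sum_{J\le N+S}\binom RI\binom{N+S}J\,h'_{I,J}\Bigr)^2,$$ where $h'_{I,J}=h_{m-1,\ell/2,I,J}(f)$ for even $\ell$ and $h'_{I,J}=h_{m-1,(\ell-1)/2,J,I}(f)$ for odd $\ell$. Let $\mathcal A_\hbar$ be the set of real-analytic $f:\mathbb C^n\to\mathbb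 C$ such that $\|f\|_{m,\ell,R,S}=h_{m,\ell,R,S}(f)^{1/2^{m+1}}<\infty$ for all $m,\ell,R,S$. Put $\Psi_f(\bar z)=\sum_I\frac1{I!}\,\partial_{\bar z}^I f(0)\,\bar z^I$ and $\mathfrak D=\{\Psi_f : f\in\mathcal A_\hbar\}$. *The Bargmann-Fock space.* Let $\mathfrak H_{BF}$ be the space of anti-holomorphic functions on $\mathbb C^n$ that are square-integrable for the measure $(2\pi\hbar)^{-n}e^{-|z|^2/2\hbar}\,dx\,dy$, with the $L^2$ inner product. *The Heisenberg representation.* Let $\mathsf H_n=\mathbb C^n\times\mathbb R$ with $(w,c)(w',c')=(w+w',\,c+c'+\operatorname{Im}(\bar w w'))$, and let $U$ be its unitary representation on $\mathfrak H_{BF}$ given by $$(U_{(w,c)}\psi)(\bar z)=e^{-\frac{i}{2\hbar}c-\frac{\bar w w}{4\hbar}}\,e^{-\frac{w\bar z}{2\hbar}}\,\psi(\bar z+\bar w),\qquad U_w=U_{(w,0)}.$$ *Operators.* Let $a_i=2\hbar\,\partial/\partial\bar z^i$ and let $a_i^\dagger$ be multiplication by $\bar z^i$. **Theorem.** $\mathfrak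 D$ is contained and dense in $\mathfrak H_{BF}$. For every $\psi\in\mathfrak D$: 1. For all $(w,c)\in\mathsf H_n$ one has $U_{(w,c)}\psi=\pi(u_{(w,c)})\psi$, where $u_{(w,c)}(z,\bar z)=e^{-\frac{i}{2\hbar}c-\frac{\bar w w}{4\hbar}+\frac1{2\hbar}(\bar w z-w\bar z)}$ and $$\pi(f)\psi=\sum_I\frac{(2\hbar)^{|I|}}{I!}\Bigl(\sum_J\frac1{J!}\,\partial_z^I\partial_{\bar z}^J f(0)\,\bar z^J\Bigr)\partial_{\bar z}^I\psi$$ is the Bargmann-Fock representation; here the sum over $I$ converges unconditionally at every point. 2. $\psi$ is an analytic vector for $U$: the map $\mathsf H_n\ni(w,c)\mapsto U_{(w,c)}\psi\in\mathfrak H_{BF}$ is real-analytic for the norm topology. 3. For every $w\in\mathbb C^n$ all terms of the following series lie in $\mathfrak H_{BF}$, and $$U_w\psi=\sum_{r=0}^\infty\frac1{r!}\Bigl(\frac1{2\hbar}\Bigr)^r\Bigl(\sum_{i=1}^n\bar w^i a_i-w^i a_i^\dagger\Bigr)^r\psi$$ converges unconditionally in the norm of $\mathfrak H_{BF}$. 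-/

import Mathlib

open MeasureTheory
open scoped ENNReal ComplexConjugate

noncomputable section

namespace WickBF

/-! ## Wirtinger derivatives and multiindices on `ℂⁿ` -/

/-- `∂f/∂zⁱ = (∂f/∂xⁱ - i ∂f/∂yⁱ) / 2`. -/
def dz {n : ℕ} (i : Fin n) (f : (Fin n → ℂ) → ℂ) : (Fin n → ℂ) → ℂ := fun z =>
  (1 / 2 : ℂ) * (fderiv ℝ f z (Pi.single i 1) - Complex.I * fderiv ℝ f z (Pi.single i Complex.I))

/-- `∂f/∂z̄ⁱ = (∂f/∂xⁱ + i ∂f/∂yⁱ) / 2`. -/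
def dzbar {n : ℕ} (i : Fin n) (f : (Fin n → ℂ) → ℂ) : (Fin n → ℂ) → ℂ := fun z =>
  (1 / 2 : ℂ) * (fderiv ℝ f z (Pi.single i 1) + Complex.I * fderiv ℝ f z (Pi.single i Complex.I))

/-- `∂^{|R|} f / ∂z^R` for a multiindex `R`. -/
def dzPow {n : ℕ} (R : Fin n → ℕ) (f : (Fin n → ℂ) → ℂ) : (Fin n → ℂ) → ℂ :=
  (List.finRange n).foldr (fun i g => (dz i)^[R i] g) f

/-- `∂^{|S|} f / ∂z̄^S` for a multiindex `S`. -/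
def dzbarPow {n : ℕ} (S : Fin n → ℕ) (f : (Fin n → ℂ) → ℂ) : (Fin n → ℂ) → ℂ :=
  (List.finRange n).foldr (fun i g => (dzbar i)^[S i] g) f

/-- `|R| = r₁ + ⋯ + rₙ`. -/
def deg {n : ℕ} (R : Fin n → ℕ) : ℕ := ∑ i, R i

/-- `R! = r₁! ⋯ rₙ!`. -/
def mfact {n : ℕ} (R : Fin n → ℕ) : ℕ := ∏ i, (R i).factorial

/-- The multiindex binomial coefficient. -/
def mchoose {n : ℕ} (R I : Fin n → ℕ) : ℕ := ∏ i, (R i).choose (I i)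

/-! ## The function space `𝒜_ħ` -/

/-- The recursively defined quantities `h^{p,ħ}_{m,ℓ,R,S}(f) ∈ [0, ∞]`. -/
def hSem {n : ℕ} (hbar : ℝ) (p : Fin n → ℂ) (f : (Fin n → ℂ) → ℂ) :
    ℕ → ℕ → (Fin n → ℕ) → (Fin n → ℕ) → ℝ≥0∞
  | 0, _, R, S => ∑' N : Fin n → ℕ,
      ENNReal.ofReal ((2 * hbar) ^ (deg R + deg S + deg N) / (mfact N : ℝ) *
        ‖dzPow R (dzbarPow (N + S) f) p‖ ^ 2)
  | m + 1, l, R, S =>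
      if Even l then
        ∑' N : Fin n → ℕ, (mfact N : ℝ≥0∞)⁻¹ *
          (∑ I ∈ Finset.Icc 0 R, ∑ J ∈ Finset.Icc 0 (N + S),
            (mchoose R I : ℝ≥0∞) * (mchoose (N + S) J : ℝ≥0∞) *
              hSem hbar p f m (l / 2) I J) ^ 2
      else
        ∑' N : Fin n → ℕ, (mfact N : ℝ≥0∞)⁻¹ *
          (∑ I ∈ Finset.Icc 0 R, ∑ J ∈ Finset.Icc 0 (N + S),
            (mchoose R I : ℝ≥0∞) * (mchoose (N + S) J : ℝ≥0∞) *
              hSem hbar p f m ((l - 1) / 2) J I) ^ 2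

/-- The seminorms `‖f‖_{m,ℓ,R,S} = (h_{m,ℓ,R,S}(f))^{1/2^{m+1}} ∈ [0, ∞]`. -/
def semi {n : ℕ} (hbar : ℝ) (p : Fin n → ℂ) (f : (Fin n → ℂ) → ℂ)
    (m l : ℕ) (R S : Fin n → ℕ) : ℝ≥0∞ :=
  hSem hbar p f m l R S ^ (1 / (2 : ℝ) ^ (m + 1))

/-- `𝒜_{p,ħ}`: the real-analytic functions on `ℂⁿ` all of whose seminorms at `p` are finite.
These are the unique real-analytic representatives of the smooth functions with finite seminorms
modulo those with vanishing infinite jet at `p`. -/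
def Aph (n : ℕ) (hbar : ℝ) (p : Fin n → ℂ) : Set ((Fin n → ℂ) → ℂ) :=
  {f | AnalyticOnNhd ℝ f Set.univ ∧
    ∀ m l : ℕ, l < 2 ^ m → ∀ R S : Fin n → ℕ, semi hbar p f m l R S < ∞}

/-- The `z̄`-Taylor expansion `Ψ_f(z) = ∑_I (1/I!) (∂^{|I|} f / ∂z̄^I)(0) z̄^I`. -/
def Psi {n : ℕ} (f : (Fin n → ℂ) → ℂ) : (Fin n → ℂ) → ℂ := fun z =>
  ∑' I : Fin n → ℕ, (mfact I : ℂ)⁻¹ * dzbarPow I f 0 * ∏ i, conj (z i) ^ I i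

/-- The space `𝔇`, the image of `𝒜_ħ = 𝒜_{0,ħ}` under `Ψ`. -/
def D (n : ℕ) (hbar : ℝ) : Set ((Fin n → ℂ) → ℂ) := Psi '' Aph n hbar 0

/-! ## The Bargmann-Fock Hilbert space -/

/-- Anti-holomorphic functions: `z ↦ ψ(z̄)` is holomorphic on `ℂⁿ`. -/
def AntiHol {n : ℕ} (ψ : (Fin n → ℂ) → ℂ) : Prop := Differentiable ℂ fun z => ψ (star z)

/-- The density `(2πħ)⁻ⁿ exp(-|z|²/2ħ)`. -/
def rho (n : ℕ) (hbar : ℝ) (z : Fin n → ℂ) : ℝ :=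
  ((2 * Real.pi * hbar) ^ n)⁻¹ * Real.exp (-(∑ i, ‖z i‖ ^ 2) / (2 * hbar))

/-- The Gaussian measure on `ℂⁿ`. -/
def gaussian (n : ℕ) (hbar : ℝ) : Measure (Fin n → ℂ) :=
  volume.withDensity fun z => ENNReal.ofReal (rho n hbar z)

/-- The vector space of Gaussian square-integrable anti-holomorphic functions. -/
def bfSpace (n : ℕ) (hbar : ℝ) : Submodule ℂ ((Fin n → ℂ) → ℂ) where
  carrier := {ψ | AntiHol ψ ∧ MemLp ψ 2 (gaussian n hbar)}
  add_mem' := fun ha hb => ⟨Differentiable.add ha.1 hb.1, ha.2.add hb.2⟩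
  zero_mem' := ⟨differentiable_const 0, MemLp.zero⟩
  smul_mem' := fun c _ ha => ⟨Differentiable.const_smul ha.1 c, ha.2.const_smul c⟩

/-- The Bargmann-Fock space as a type of its own, to carry the Hilbert space structure (and not
the topology of pointwise convergence). -/
def HBF (n : ℕ) (hbar : ℝ) : Type := bfSpace n hbar

instance (n : ℕ) (hbar : ℝ) : AddCommGroup (HBF n hbar) :=
  inferInstanceAs (AddCommGroup (bfSpace n hbar))

instance (n : ℕ) (hbar : ℝ) : Module ℂ (HBF n hbar) :=
  inferInstanceAs (Module ℂ (bfSpace n hbar))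

/-- The function on `ℂⁿ` underlying an element of the Bargmann-Fock space. -/
def HBF.fn {n : ℕ} {hbar : ℝ} (ψ : HBF n hbar) : (Fin n → ℂ) → ℂ :=
  Subtype.val (p := fun φ => φ ∈ bfSpace n hbar) ψ

instance (n : ℕ) (hbar : ℝ) : CoeFun (HBF n hbar) fun _ => (Fin n → ℂ) → ℂ := ⟨HBF.fn⟩

theorem HBF.mem {n : ℕ} {hbar : ℝ} (ψ : HBF n hbar) : ψ.fn ∈ bfSpace n hbar :=
  Subtype.property (p := fun φ => φ ∈ bfSpace n hbar) ψ

theorem HBF.ext' {n : ℕ} {hbar : ℝ} {φ ψ : HBF n hbar} (h : φ.fn = ψ.fn) : φ = ψ :=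
  Subtype.ext h

theorem AntiHol.continuous {n : ℕ} {ψ : (Fin n → ℂ) → ℂ} (h : AntiHol ψ) : Continuous ψ := by
  have h1 : Continuous fun z => ψ (star (star z)) :=
    (Differentiable.continuous h).comp continuous_star
  simpa using h1

theorem rho_pos (n : ℕ) (hbar : ℝ) [hh : Fact (0 < hbar)] (z : Fin n → ℂ) :
    0 < rho n hbar z := by
  have := hh.out
  unfold rho
  positivity

theorem rho_continuous (n : ℕ) (hbar : ℝ) : Continuous (rho n hbar) := by
  unfold rho
  fun_prop

theorem gaussian_integral (n : ℕ) (hbar : ℝ) [Fact (0 < hbar)] (F : (Fin n → ℂ) → ℂ) :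
    ∫ z, F z ∂(gaussian n hbar) = ∫ z, rho n hbar z • F z := by
  unfold gaussian
  rw [integral_withDensity_eq_integral_toReal_smul
    ((rho_continuous n hbar).measurable.ennreal_ofReal) (by simp)]
  simp [ENNReal.toReal_ofReal (rho_pos n hbar _).le]

theorem gaussian_integrable (n : ℕ) (hbar : ℝ) [Fact (0 < hbar)] (F : (Fin n → ℂ) → ℝ) :
    Integrable F (gaussian n hbar) ↔ Integrable fun z => rho n hbar z • F z := by
  unfold gaussian
  rw [integrable_withDensity_iff_integrable_smul'
    ((rho_continuous n hbar).measurable.ennreal_ofReal) (by simp)]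
  simp [ENNReal.toReal_ofReal (rho_pos n hbar _).le]

theorem integrable_inner {n : ℕ} {hbar : ℝ} (φ ψ : HBF n hbar) :
    Integrable (fun z => conj (φ z) * ψ z) (gaussian n hbar) :=
  MemLp.integrable_mul (MemLp.star φ.mem.2) ψ.mem.2

/-- The inner product `⟨φ, ψ⟩ = ∫ conj(φ) ψ dμ` with respect to the Gaussian measure. -/
instance bfCore (n : ℕ) (hbar : ℝ) [Fact (0 < hbar)] : InnerProductSpace.Core ℂ (HBF n hbar) where
  inner φ ψ := ∫ z, conj (φ z) * ψ z ∂(gaussian n hbar)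
  conj_inner_symm φ ψ := by
    rw [← integral_conj]
    congr 1
    ext z
    simp [mul_comm]
  re_inner_nonneg φ := by
    have : (∫ z, conj (φ z) * φ z ∂(gaussian n hbar))
        = ((∫ z, ‖φ z‖ ^ 2 ∂(gaussian n hbar) : ℝ) : ℂ) := by
      rw [← integral_complex_ofReal]
      congr 1
      ext z
      simp [Complex.conj_mul']
    rw [this]
    exact integral_nonneg fun z => by positivity
  add_left φ ψ χ := by
    rw [← integral_add (integrable_inner φ χ) (integrable_inner ψ χ)]
    congr 1
    ext z
    change conj (φ z + ψ z) * χ z = _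
    simp [add_mul]
  smul_left φ ψ r := by
    rw [← integral_const_mul]
    congr 1
    ext z
    change conj (r * φ z) * ψ z = _
    simp [mul_assoc]
  definite φ h := by
    have h1 : (∫ z, conj (φ z) * φ z ∂(gaussian n hbar))
        = ((∫ z, rho n hbar z • ‖φ z‖ ^ 2 : ℝ) : ℂ) := by
      rw [gaussian_integral, ← integral_complex_ofReal]
      congr 1
      ext z
      simp [Complex.conj_mul']
    have h2 : (∫ z, rho n hbar z • ‖φ z‖ ^ 2) = 0 := by
      have := h1.symm.trans h
      exact_mod_cast this
    have hc : Continuous φ.fn := φ.mem.1.continuous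
    have hI : Integrable fun z => rho n hbar z • ‖φ z‖ ^ 2 :=
      (gaussian_integrable n hbar _).1
        ((memLp_two_iff_integrable_sq_norm φ.mem.2.1).1 φ.mem.2)
    have h3 := (integral_eq_zero_iff_of_nonneg
      (fun z => smul_nonneg (rho_pos n hbar z).le (sq_nonneg ‖φ z‖)) hI).1 h2
    have h4 := Continuous.ae_eq_iff_eq volume
      ((rho_continuous n hbar).smul (hc.norm.pow 2)) continuous_zero |>.1 h3
    apply HBF.ext'
    funext z
    have h5 := congrFun h4 z
    change φ z = 0
    simpa [(rho_pos n hbar z).ne'] using h5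

instance (n : ℕ) (hbar : ℝ) [Fact (0 < hbar)] : NormedAddCommGroup (HBF n hbar) :=
  (bfCore n hbar).toNormedAddCommGroup

instance (n : ℕ) (hbar : ℝ) [Fact (0 < hbar)] : InnerProductSpace ℂ (HBF n hbar) :=
  InnerProductSpace.ofCore (bfCore n hbar).toCore

/-! ## The Heisenberg group and its unitary representation -/

/-- The Heisenberg group `ℂⁿ × ℝ`. -/
@[ext]
structure Heis (n : ℕ) where
  w : Fin n → ℂ
  c : ℝ

/-- The multiplication `(w, c) (w', c') = (w + w', c + c' + Im(w̄ w'))`. -/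
instance (n : ℕ) : Mul (Heis n) :=
  ⟨fun g h => ⟨g.w + h.w, g.c + h.c + (∑ i, conj (g.w i) * h.w i).im⟩⟩

instance (n : ℕ) : One (Heis n) := ⟨⟨0, 0⟩⟩

instance (n : ℕ) : Inv (Heis n) := ⟨fun g => ⟨-g.w, -g.c⟩⟩

instance (n : ℕ) : Group (Heis n) :=
  Group.ofLeftAxioms
    (fun a b d => by
      apply Heis.ext
      · exact add_assoc _ _ _
      · change a.c + b.c + (∑ i, conj (a.w i) * b.w i).im + d.c
            + (∑ i, conj (a.w i + b.w i) * d.w i).im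
          = a.c + (b.c + d.c + (∑ i, conj (b.w i) * d.w i).im)
            + (∑ i, conj (a.w i) * (b.w i + d.w i)).im
        simp only [map_add, add_mul, mul_add, Finset.sum_add_distrib, Complex.add_im]
        ring)
    (fun a => by
      apply Heis.ext
      · exact zero_add _
      · change 0 + a.c + (∑ i, conj (0 : ℂ) * a.w i).im = a.c
        simp)
    (fun a => by
      apply Heis.ext
      · exact neg_add_cancel _
      · change -a.c + a.c + (∑ i, conj (-a.w i) * a.w i).im = 0
        simp [mul_comm])

/-- `(U_{(w,c)} ψ)(z̄) = exp(-ic/2ħ - w̄w/4ħ) exp(-w z̄/2ħ) ψ(z̄ + w̄)`, on arbitrary functions. -/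
def actFun {n : ℕ} (hbar : ℝ) (g : Heis n) (ψ : (Fin n → ℂ) → ℂ) : (Fin n → ℂ) → ℂ := fun z =>
  Complex.exp (-(Complex.I / (2 * hbar)) * g.c - (∑ i, conj (g.w i) * g.w i) / (4 * hbar)) *
    Complex.exp (-(∑ i, g.w i * conj (z i)) / (2 * hbar)) * ψ (z + g.w)

theorem actFun_mul {n : ℕ} (hbar : ℝ) (g h : Heis n) (ψ : (Fin n → ℂ) → ℂ) :
    actFun hbar (g * h) ψ = actFun hbar g (actFun hbar h ψ) := by
  funext z
  change Complex.exp (-(Complex.I / (2 * hbar)) *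
        ((g.c + h.c + (∑ i, conj (g.w i) * h.w i).im : ℝ) : ℂ)
      - (∑ i, conj (g.w i + h.w i) * (g.w i + h.w i)) / (4 * hbar)) *
    Complex.exp (-(∑ i, (g.w i + h.w i) * conj (z i)) / (2 * hbar)) * ψ (z + (g.w + h.w))
    = Complex.exp (-(Complex.I / (2 * hbar)) * g.c - (∑ i, conj (g.w i) * g.w i) / (4 * hbar)) *
      Complex.exp (-(∑ i, g.w i * conj (z i)) / (2 * hbar)) *
      (Complex.exp (-(Complex.I / (2 * hbar)) * h.c - (∑ i, conj (h.w i) * h.w i) / (4 * hbar)) *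
      Complex.exp (-(∑ i, h.w i * conj (z i + g.w i)) / (2 * hbar)) * ψ (z + g.w + h.w))
  rw [← add_assoc z]
  have key : ∀ a b c d e f x : ℂ, a + b = c + d + (e + f) →
      Complex.exp a * Complex.exp b * x
        = Complex.exp c * Complex.exp d * (Complex.exp e * Complex.exp f * x) := by
    intro a b c d e f x hh
    rw [← Complex.exp_add, hh, Complex.exp_add, Complex.exp_add, Complex.exp_add]
    ring
  apply key
  have him : Complex.I * (((∑ i, conj (g.w i) * h.w i).im : ℝ) : ℂ)
      = ((∑ i, conj (g.w i) * h.w i) - ∑ i, g.w i * conj (h.w i)) / 2 := by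
    have h1 : (∑ i, g.w i * conj (h.w i)) = conj (∑ i, conj (g.w i) * h.w i) := by
      simp
    rw [h1, Complex.sub_conj]
    push_cast
    ring
  have hco : ∑ i, h.w i * conj (g.w i) = ∑ i, conj (g.w i) * h.w i :=
    Finset.sum_congr rfl fun i _ => mul_comm _ _
  have hco2 : ∑ i, conj (h.w i) * g.w i = ∑ i, g.w i * conj (h.w i) :=
    Finset.sum_congr rfl fun i _ => mul_comm _ _
  simp only [map_add, add_mul, mul_add, Finset.sum_add_distrib, Complex.ofReal_add, hco, hco2]
  linear_combination (-1 / (2 * (hbar : ℂ))) * him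

theorem actFun_one {n : ℕ} (hbar : ℝ) (ψ : (Fin n → ℂ) → ℂ) : actFun hbar 1 ψ = ψ := by
  funext z
  change Complex.exp (-(Complex.I / (2 * hbar)) * ((0 : ℝ) : ℂ)
      - (∑ i : Fin n, conj (0 : ℂ) * (0 : ℂ)) / (4 * hbar)) *
    Complex.exp (-(∑ i, (0 : ℂ) * conj (z i)) / (2 * hbar)) * ψ (z + 0) = ψ z
  simp

theorem rho_actFun {n : ℕ} (hbar : ℝ) [hh : Fact (0 < hbar)] (g : Heis n)
    (ψ : (Fin n → ℂ) → ℂ) (z : Fin n → ℂ) :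
    rho n hbar z • ‖actFun hbar g ψ z‖ ^ 2 = rho n hbar (z + g.w) • ‖ψ (z + g.w)‖ ^ 2 := by
  have hne : hbar ≠ 0 := hh.out.ne'
  unfold actFun rho
  rw [norm_mul, norm_mul, Complex.norm_exp, Complex.norm_exp, smul_eq_mul, smul_eq_mul]
  have key : ∀ k a b c x : ℝ, k * Real.exp a * (Real.exp b * Real.exp c * x) ^ 2
      = k * Real.exp (a + (2 * b + 2 * c)) * x ^ 2 := by
    intro k a b c x
    rw [Real.exp_add, Real.exp_add, two_mul, two_mul, Real.exp_add, Real.exp_add]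
    ring
  have e1 : (-(Complex.I / (2 * (hbar : ℂ))) * g.c
      - (∑ i, conj (g.w i) * g.w i) / (4 * (hbar : ℂ))).re
      = -(∑ i, ‖g.w i‖ ^ 2) / (4 * hbar) := by
    have : -(Complex.I / (2 * (hbar : ℂ))) * g.c
        - (∑ i, conj (g.w i) * g.w i) / (4 * (hbar : ℂ))
        = ((-(∑ i, ‖g.w i‖ ^ 2) / (4 * hbar) : ℝ) : ℂ) + ((-g.c / (2 * hbar) : ℝ) : ℂ)
          * Complex.I := by
      simp only [Complex.conj_mul']
      push_cast
      ring
    rw [this]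
    simp only [Complex.add_re, Complex.ofReal_re, Complex.re_ofReal_mul, Complex.I_re, mul_zero,
      add_zero]
  have e2 : (-(∑ i, g.w i * conj (z i)) / (2 * (hbar : ℂ))).re
      = -(∑ i, (g.w i * conj (z i)).re) / (2 * hbar) := by
    have : (2 * (hbar : ℂ)) = ((2 * hbar : ℝ) : ℂ) := by push_cast; rfl
    rw [this, Complex.div_ofReal_re, Complex.neg_re, Complex.re_sum]
  have e3 : ∑ i, ‖(z + g.w) i‖ ^ 2
      = ∑ i, ‖z i‖ ^ 2 + ∑ i, ‖g.w i‖ ^ 2 + 2 * ∑ i, (g.w i * conj (z i)).re := by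
    rw [Finset.mul_sum, ← Finset.sum_add_distrib, ← Finset.sum_add_distrib]
    refine Finset.sum_congr rfl fun i _ => ?_
    simp only [Pi.add_apply, Complex.sq_norm, Complex.normSq_apply, Complex.add_re,
      Complex.add_im, Complex.mul_re, Complex.conj_re, Complex.conj_im]
    ring
  rw [key, e1, e2, e3]
  congr 3
  field_simp
  ring

theorem actFun_mem {n : ℕ} (hbar : ℝ) [Fact (0 < hbar)] (g : Heis n) {ψ : (Fin n → ℂ) → ℂ}
    (h : ψ ∈ bfSpace n hbar) : actFun hbar g ψ ∈ bfSpace n hbar := by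
  have h1 : AntiHol (actFun hbar g ψ) := by
    have e : (fun z => actFun hbar g ψ (star z)) = fun z =>
        Complex.exp (-(Complex.I / (2 * hbar)) * g.c
          - (∑ i, conj (g.w i) * g.w i) / (4 * hbar)) *
        Complex.exp (-(∑ i, g.w i * z i) / (2 * hbar)) *
          (fun y => ψ (star y)) (z + star g.w) := by
      funext z
      simp [actFun]
    unfold AntiHol
    rw [e]
    have h2 : Differentiable ℂ fun z => (fun y => ψ (star y)) (z + star g.w) :=
      Differentiable.comp (g := fun y => ψ (star y)) h.1 (by fun_prop)
    refine Differentiable.mul ?_ h2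
    fun_prop
  refine ⟨h1, ?_⟩
  rw [memLp_two_iff_integrable_sq_norm h1.continuous.aestronglyMeasurable, gaussian_integrable]
  have h3 := (gaussian_integrable n hbar _).1 ((memLp_two_iff_integrable_sq_norm h.2.1).1 h.2)
  simp_rw [rho_actFun]
  exact h3.comp_add_right g.w

theorem bf_norm_sq {n : ℕ} {hbar : ℝ} [Fact (0 < hbar)] (ψ : HBF n hbar) :
    ‖ψ‖ ^ 2 = ∫ z, rho n hbar z • ‖ψ z‖ ^ 2 := by
  have h1 : inner ℂ ψ ψ = ((∫ z, rho n hbar z • ‖ψ z‖ ^ 2 : ℝ) : ℂ) := by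
    change (∫ z, conj (ψ z) * ψ z ∂(gaussian n hbar)) = _
    rw [gaussian_integral, ← integral_complex_ofReal]
    congr 1
    ext z
    simp [Complex.conj_mul']
  rw [inner_self_eq_norm_sq_to_K] at h1
  apply Complex.ofReal_injective
  rw [← h1, Complex.ofReal_pow]
  rfl

/-- `U_{(w,c)}` as a linear isometry of the Bargmann-Fock space. -/
def actIso {n : ℕ} (hbar : ℝ) [Fact (0 < hbar)] (g : Heis n) :
    HBF n hbar →ₗᵢ[ℂ] HBF n hbar where
  toFun ψ := ⟨actFun hbar g ψ, actFun_mem hbar g ψ.mem⟩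
  map_add' φ ψ := by
    apply HBF.ext'
    funext z
    exact mul_add _ _ _
  map_smul' r ψ := by
    apply HBF.ext'
    funext z
    exact mul_left_comm _ _ _
  norm_map' ψ := by
    refine (sq_eq_sq₀ (norm_nonneg _) (norm_nonneg _)).1 ?_
    rw [bf_norm_sq, bf_norm_sq]
    change (∫ z, rho n hbar z • ‖actFun hbar g ψ z‖ ^ 2) = _
    simp_rw [rho_actFun]
    exact integral_add_right_eq_self (fun z => rho n hbar z • ‖ψ z‖ ^ 2) g.w

/-- The unitary representation `U` of the Heisenberg group on the Bargmann-Fock space. -/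
def U (n : ℕ) (hbar : ℝ) [Fact (0 < hbar)] : Heis n →* (HBF n hbar ≃ₗᵢ[ℂ] HBF n hbar) where
  toFun g :=
    { toLinearEquiv := LinearEquiv.ofLinearMap (actIso hbar g).toLinearMap
        (actIso hbar g⁻¹).toLinearMap
        (by
          ext1 ψ
          apply HBF.ext'
          change actFun hbar g (actFun hbar g⁻¹ ψ) = ψ
          rw [← actFun_mul, mul_inv_cancel, actFun_one])
        (by
          ext1 ψ
          apply HBF.ext'
          change actFun hbar g⁻¹ (actFun hbar g ψ) = ψ
          rw [← actFun_mul, inv_mul_cancel, actFun_one])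
      norm_map' := (actIso hbar g).norm_map' }
  map_one' := by
    ext1 ψ
    apply HBF.ext'
    exact actFun_one hbar ψ
  map_mul' g h := by
    ext1 ψ
    apply HBF.ext'
    exact actFun_mul hbar g h ψ

/-- `ψ` is an analytic vector of a representation of the Heisenberg group: its orbit map is
real-analytic on the whole group, in the global coordinates `(w, c) ∈ ℂⁿ × ℝ`. -/
def IsAnalyticVector {n : ℕ} {H : Type*} [NormedAddCommGroup H] [InnerProductSpace ℂ H]
    (V : Heis n →* (H ≃ₗᵢ[ℂ] H)) (ψ : H) : Prop :=
  AnalyticOnNhd ℝ (fun x : (Fin n → ℂ) × ℝ => V ⟨x.1, x.2⟩ ψ) Set.univ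

/-! ## The Bargmann-Fock representation and the creation and annihilation operators -/

/-- `e_{ᾱ,β}(z, z̄) = exp(ħ ᾱ β) exp(ᾱ z + β z̄)`. -/
def expFun {n : ℕ} (hbar : ℝ) (α β : Fin n → ℂ) : (Fin n → ℂ) → ℂ := fun z =>
  Complex.exp (hbar * ∑ i, conj (α i) * β i) *
    Complex.exp (∑ i, (conj (α i) * z i + β i * conj (z i)))

/-- `u_{(w,c)} = exp(-ic/2ħ) e_{w̄/2ħ, -w/2ħ}`. -/
def heisFun {n : ℕ} (hbar : ℝ) (g : Heis n) : (Fin n → ℂ) → ℂ := fun z =>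
  Complex.exp (-(Complex.I / (2 * hbar)) * g.c) *
    expFun hbar (fun i => g.w i / (2 * hbar)) (fun i => -g.w i / (2 * hbar)) z

/-- The `I`-th term of the series
`π(f)ψ = ∑_I ((2ħ)^{|I|} / I!) (∑_J (1/J!) (∂^{|I|+|J|} f / ∂z^I ∂z̄^J)(0) z̄^J) ∂^{|I|}ψ/∂z̄^I`
defining the Bargmann-Fock representation `π`. -/
def bfRepTerm {n : ℕ} (hbar : ℝ) (f ψ : (Fin n → ℂ) → ℂ) (I : Fin n → ℕ) :
    (Fin n → ℂ) → ℂ := fun z =>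
  ((2 * hbar : ℝ) : ℂ) ^ deg I / (mfact I : ℂ) * Psi (dzPow I f) z * dzbarPow I ψ z

/-- The annihilation operator `a_i = 2ħ ∂/∂z̄ⁱ`. -/
def annih {n : ℕ} (hbar : ℝ) (i : Fin n) (ψ : (Fin n → ℂ) → ℂ) : (Fin n → ℂ) → ℂ := fun z =>
  2 * hbar * dzbar i ψ z

/-- The creation operator `a_i†`, multiplication by `z̄ⁱ`. -/
def creat {n : ℕ} (i : Fin n) (ψ : (Fin n → ℂ) → ℂ) : (Fin n → ℂ) → ℂ := fun z =>
  conj (z i) * ψ z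

/-- The operator `∑_i (w̄ⁱ a_i - wⁱ a_i†)`. -/
def fieldOp {n : ℕ} (hbar : ℝ) (w : Fin n → ℂ) (ψ : (Fin n → ℂ) → ℂ) : (Fin n → ℂ) → ℂ :=
  ∑ i, (conj (w i) • annih hbar i ψ - w i • creat i ψ)

end WickBF

end

noncomputable section

namespace WickBF

/-! ## Multiindex series -/

section Multiindex

variable {n : ℕ}

/-! Everything is read off the Taylor coefficients `b` of an anti-holomorphic function `antiSeries
b`, that is `∑ b_N z̄^N / N!`.

Membership in 𝔇 forces fast decay of `b`. Keeping one summand of `h_{1,0,0,0}` gives `((2ħ)^|N|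
|b_N|²)² ≤ H N!`, so `|b_N|²` is of order `√N!` up to a geometric factor. The spare `√N!` beats
every geometric sequence: for each `K` there is a `C` with `|b_N|² K^|N| ≤ C N!`, which is `Rapid
b`. All statements about a vector of 𝔇 use only this decay. Conversely, polynomials in `z̄` are in
𝔇, because a bound exponential in `|R| + |S|` on the `h_{m,ℓ,R,S}` survives the recursion; this
gives density.

The Bargmann-Fock norm is a weighted ℓ² norm of `b`. The monomials are orthonormal after scaling,
and they span a dense subspace: by the mean value property `⟨1, ψ⟩ = ψ(0)`, hence by unitarity a
vector orthogonal to all coherent states `U_g 1` vanishes at every point, while coherent states are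
ℓ² combinations of monomials (`synth_surjective`).

The formula for `π(u_{(w,c)})` is Taylor's formula for `ψ(z̄ + w̄)`, since `u_{(w,c)}` is an
exponential and thus an eigenfunction of all Wirtinger derivatives (`hasSum_bfRepTerm_heisFun`).

For the exponential series, a product of `r` creation and annihilation operators applied to a rapid
vector has norm at most `A B^r √r!` (`Rapid.exists_norm_word_le`). There are `(2n)^r` such products
and a factor `1/r!`, so the series is dominated by `∑ Q^r / √r!` and is a power series in `w` of
infinite radius. Its sum is `U_w ψ`: at each point, `t ↦ (U_{tw} ψ)(z)` has the expected
derivatives, and its Taylor remainder tends to zero because `U` is isometric and evaluation is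
bounded (`tendsto_orbitSeries_apply`). Analyticity in `(w, c)` follows, as `c` acts by a phase. -/

theorem deg_add (M N : Fin n → ℕ) : deg (M + N) = deg M + deg N := by
  simp [deg, Finset.sum_add_distrib]

theorem deg_single (i : Fin n) (k : ℕ) : deg (Pi.single i k : Fin n → ℕ) = k := by
  simp [deg]

theorem mfact_pos (N : Fin n → ℕ) : 0 < mfact N :=
  Finset.prod_pos fun _ _ => Nat.factorial_pos _

theorem mfact_add_single (N : Fin n → ℕ) (i : Fin n) :
    mfact (N + Pi.single i 1) = (N i + 1) * mfact N := by
  unfold mfact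
  rw [← Finset.mul_prod_erase _ _ (Finset.mem_univ i),
    ← Finset.mul_prod_erase _ (fun j => (N j).factorial) (Finset.mem_univ i), ← mul_assoc]
  congr 1
  · simp [Nat.factorial_succ]
  · refine Finset.prod_congr rfl fun j hj => ?_
    simp [Pi.single_eq_of_ne (Finset.ne_of_mem_erase hj)]

theorem prod_pow_eq_pow_deg {R : Type*} [CommMonoid R] (r : R) (N : Fin n → ℕ) :
    ∏ i, r ^ N i = r ^ deg N :=
  Finset.prod_pow_eq_pow_sum _ _ _

theorem norm_prod_pow_le (y : Fin n → ℂ) (N : Fin n → ℕ) :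
    ‖∏ i, y i ^ N i‖ ≤ ‖y‖ ^ deg N := by
  rw [norm_prod, ← prod_pow_eq_pow_deg]
  refine Finset.prod_le_prod (fun _ _ => norm_nonneg _) fun i _ => ?_
  rw [norm_pow]
  exact pow_le_pow_left₀ (norm_nonneg _) (norm_le_pi_norm y i) _

/-- Induction on `n`: the first coordinate is split off, and two absolutely convergent series are
multiplied. -/
theorem summable_tsum_pi_prod {𝕜 : Type*} [RCLike 𝕜] : ∀ {n : ℕ} (f : Fin n → ℕ → 𝕜),
    (∀ i, Summable fun k => ‖f i k‖) →
    (Summable fun N : Fin n → ℕ => ‖∏ i, f i (N i)‖) ∧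
      ∑' N : Fin n → ℕ, ∏ i, f i (N i) = ∏ i, ∑' k, f i k
  | 0, f, _ => by
      refine ⟨(hasSum_unique _).summable, ?_⟩
      rw [tsum_eq_single default fun N hN => absurd (Subsingleton.elim N default) hN]
      simp
  | n + 1, f, hf => by
      obtain ⟨h1, h2⟩ := summable_tsum_pi_prod (fun i : Fin n => f i.succ) fun i => hf i.succ
      have e : ∀ p : ℕ × (Fin n → ℕ),
          ∏ i, f i ((Fin.consEquiv fun _ : Fin (n + 1) => ℕ) p i)
            = f 0 p.1 * ∏ i : Fin n, f i.succ (p.2 i) := by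
        intro p
        rw [Fin.prod_univ_succ]
        rfl
      constructor
      · rw [← (Fin.consEquiv fun _ : Fin (n + 1) => ℕ).summable_iff]
        refine (Summable.mul_norm (hf 0) h1).congr fun p => ?_
        rw [Function.comp_apply, e]
      · rw [← (Fin.consEquiv fun _ : Fin (n + 1) => ℕ).tsum_eq, Fin.prod_univ_succ, ← h2,
          tsum_mul_tsum_of_summable_norm (hf 0) h1]
        exact tsum_congr e

theorem hasSum_pi_prod {𝕜 : Type*} [RCLike 𝕜] (f : Fin n → ℕ → 𝕜)
    (hf : ∀ i, Summable fun k => ‖f i k‖) :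
    HasSum (fun N : Fin n → ℕ => ∏ i, f i (N i)) (∏ i, ∑' k, f i k) := by
  obtain ⟨h1, h2⟩ := summable_tsum_pi_prod f hf
  exact h2 ▸ h1.of_norm.hasSum

theorem summable_geometric_deg {r : ℝ} (h0 : 0 ≤ r) (h1 : r < 1) :
    Summable fun N : Fin n → ℕ => r ^ deg N := by
  refine (hasSum_pi_prod (fun _ k => r ^ k) fun _ => ?_).summable.congr fun N =>
    prod_pow_eq_pow_deg r N
  simpa [abs_of_nonneg h0] using summable_geometric_of_lt_one h0 h1

theorem hasSum_exp_multi (y : Fin n → ℂ) :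
    HasSum (fun N : Fin n → ℕ => (mfact N : ℂ)⁻¹ * ∏ i, y i ^ N i) (Complex.exp (∑ i, y i)) := by
  have h := hasSum_pi_prod (fun i k => y i ^ k / (k.factorial : ℂ))
    fun i => NormedSpace.norm_expSeries_div_summable (y i)
  have e : ∀ i, ∑' k : ℕ, y i ^ k / (k.factorial : ℂ) = Complex.exp (y i) := fun i => by
    rw [Complex.exp_eq_exp_ℂ, NormedSpace.exp_eq_tsum_div]
  simp only [e, ← Complex.exp_sum] at h
  refine h.congr_fun ?_
  intro N
  simp [mfact, div_eq_inv_mul, Finset.prod_mul_distrib]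

theorem summable_pow_deg_div_mfact (r : ℝ) :
    Summable fun N : Fin n → ℕ => (mfact N : ℝ)⁻¹ * r ^ deg N := by
  have h := (hasSum_pi_prod (fun (_ : Fin n) k => r ^ k / (k.factorial : ℝ))
    fun i => NormedSpace.norm_expSeries_div_summable r).summable
  refine h.congr fun N => ?_
  simp [mfact, div_eq_inv_mul, Finset.prod_mul_distrib, prod_pow_eq_pow_deg]

/-- The binomial theorem padded by zeros to a series over all of ℕ, the shape that `hasSum_pi_prod`
needs to produce the multiindex version. -/
theorem hasSum_binomial {𝕜 : Type*} [RCLike 𝕜] (y w : 𝕜) (m : ℕ) :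
    (Summable fun k => ‖if k ≤ m then w ^ k / (k.factorial : 𝕜) *
      (y ^ (m - k) / ((m - k).factorial : 𝕜)) else 0‖) ∧
    ∑' k, (if k ≤ m then w ^ k / (k.factorial : 𝕜) *
      (y ^ (m - k) / ((m - k).factorial : 𝕜)) else 0) = (y + w) ^ m / (m.factorial : 𝕜) := by
  have hz : ∀ k ∉ Finset.range (m + 1), (if k ≤ m then w ^ k / (k.factorial : 𝕜) *
      (y ^ (m - k) / ((m - k).factorial : 𝕜)) else 0) = 0 := by
    intro k hk
    rw [Finset.mem_range] at hk
    exact if_neg (by omega)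
  refine ⟨summable_of_ne_finset_zero (s := Finset.range (m + 1)) fun k hk => by
    rw [hz k hk, norm_zero], ?_⟩
  rw [tsum_eq_sum hz, add_comm y w, add_pow, Finset.sum_div]
  refine Finset.sum_congr rfl fun k hk => ?_
  have hk' : k ≤ m := Nat.lt_succ_iff.1 (Finset.mem_range.1 hk)
  rw [if_pos hk', Nat.cast_choose 𝕜 hk']
  have h1 : (k.factorial : 𝕜) ≠ 0 := Nat.cast_ne_zero.2 k.factorial_ne_zero
  have h2 : ((m - k).factorial : 𝕜) ≠ 0 := Nat.cast_ne_zero.2 (m - k).factorial_ne_zero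
  have h3 : (m.factorial : 𝕜) ≠ 0 := Nat.cast_ne_zero.2 m.factorial_ne_zero
  field_simp

/-- The power series `∑_N (1/N!) b_N y^N`. -/
def expSeries (b : (Fin n → ℕ) → ℂ) (y : Fin n → ℂ) : ℂ :=
  ∑' N : Fin n → ℕ, (mfact N : ℂ)⁻¹ * b N * ∏ i, y i ^ N i

/-- The coefficient families of everywhere absolutely convergent series `expSeries`. -/
def Entire (b : (Fin n → ℕ) → ℂ) : Prop :=
  ∀ r : ℝ, 0 ≤ r → Summable fun N : Fin n → ℕ => (mfact N : ℝ)⁻¹ * ‖b N‖ * r ^ deg N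

theorem Entire.summable_norm {b : (Fin n → ℕ) → ℂ} (hb : Entire b) (y : Fin n → ℂ) :
    Summable fun N : Fin n → ℕ => ‖(mfact N : ℂ)⁻¹ * b N * ∏ i, y i ^ N i‖ := by
  refine (hb ‖y‖ (norm_nonneg _)).of_nonneg_of_le (fun _ => norm_nonneg _) fun N => ?_
  rw [norm_mul, norm_mul, norm_inv, Complex.norm_natCast]
  gcongr
  exact norm_prod_pow_le y N

theorem Entire.hasSum {b : (Fin n → ℕ) → ℂ} (hb : Entire b) (y : Fin n → ℂ) :
    HasSum (fun N : Fin n → ℕ => (mfact N : ℂ)⁻¹ * b N * ∏ i, y i ^ N i) (expSeries b y) :=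
  (hb.summable_norm y).of_norm.hasSum

/-- The terms of the double series obtained by expanding `(y + w)^M / M!`. -/
def binTerm {𝕜 : Type*} [RCLike 𝕜] (b : (Fin n → ℕ) → 𝕜) (y w : Fin n → 𝕜)
    (p : (Fin n → ℕ) × (Fin n → ℕ)) : 𝕜 :=
  b p.1 * ∏ i, if p.2 i ≤ p.1 i then w i ^ p.2 i / ((p.2 i).factorial : 𝕜) *
    (y i ^ (p.1 i - p.2 i) / ((p.1 i - p.2 i).factorial : 𝕜)) else 0

theorem hasSum_binTerm {𝕜 : Type*} [RCLike 𝕜] (b : (Fin n → ℕ) → 𝕜) (y w : Fin n → 𝕜)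
    (M : Fin n → ℕ) :
    HasSum (fun I => binTerm b y w (M, I)) ((mfact M : 𝕜)⁻¹ * b M * ∏ i, (y i + w i) ^ M i) := by
  have h := (hasSum_pi_prod (fun i k => if k ≤ M i then w i ^ k / (k.factorial : 𝕜) *
    (y i ^ (M i - k) / ((M i - k).factorial : 𝕜)) else 0)
    fun i => (hasSum_binomial (y i) (w i) (M i)).1).mul_left (b M)
  rw [Finset.prod_congr rfl fun i _ => (hasSum_binomial (y i) (w i) (M i)).2,
    Finset.prod_div_distrib] at h
  have e : ((mfact M : 𝕜)⁻¹ * b M * ∏ i, (y i + w i) ^ M i)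
      = b M * ((∏ i, (y i + w i) ^ M i) / ∏ i, ((M i).factorial : 𝕜)) := by
    simp only [mfact, Nat.cast_prod]
    ring
  rw [e]
  exact h

/-- Parametrizing the pairs `I ≤ M` by `M = N + I` separates the powers of `w` from those of `y`. -/
theorem binTerm_add {𝕜 : Type*} [RCLike 𝕜] (b : (Fin n → ℕ) → 𝕜) (y w : Fin n → 𝕜)
    (N I : Fin n → ℕ) :
    binTerm b y w (N + I, I) = ((mfact I : 𝕜)⁻¹ * ∏ i, w i ^ I i) *
      ((mfact N : 𝕜)⁻¹ * b (N + I) * ∏ i, y i ^ N i) := by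
  simp only [binTerm, Pi.add_apply, le_add_iff_nonneg_left, zero_le, if_true,
    Nat.add_sub_cancel, Finset.prod_mul_distrib, Finset.prod_div_distrib, mfact, Nat.cast_prod]
  ring

theorem binTerm_eq_zero {𝕜 : Type*} [RCLike 𝕜] (b : (Fin n → ℕ) → 𝕜) (y w : Fin n → 𝕜)
    {M I : Fin n → ℕ} (h : ¬ I ≤ M) : binTerm b y w (M, I) = 0 := by
  obtain ⟨i, hi⟩ := not_forall.1 h
  unfold binTerm
  rw [Finset.prod_eq_zero (Finset.mem_univ i) (if_neg hi), mul_zero]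

/-- The terms are nonnegative and the row over `M` sums to `‖b M‖ (r + s)^|M| / M!`, so summability
of the iterated sum suffices. This is the majorant for all rearrangements of the double series. -/
theorem Entire.summable_binTerm_real {b : (Fin n → ℕ) → ℂ} (hb : Entire b) {r s : ℝ}
    (hr : 0 ≤ r) (hs : 0 ≤ s) :
    Summable (binTerm (fun N => ‖b N‖) (fun _ : Fin n => r) (fun _ => s)) := by
  have h0 : ∀ p, 0 ≤ binTerm (fun N => ‖b N‖) (fun _ : Fin n => r) (fun _ => s) p := by
    intro p
    refine mul_nonneg (norm_nonneg _) (Finset.prod_nonneg fun i _ => ?_)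
    split_ifs <;> positivity
  rw [summable_prod_of_nonneg h0]
  refine ⟨fun M => (hasSum_binTerm _ _ _ M).summable, ?_⟩
  refine (hb (r + s) (add_nonneg hr hs)).congr fun M => ?_
  rw [(hasSum_binTerm _ _ _ M).tsum_eq, prod_pow_eq_pow_deg]

theorem Entire.summable_binTerm {b : (Fin n → ℕ) → ℂ} (hb : Entire b) (y w : Fin n → ℂ) :
    Summable (binTerm b y w) := by
  refine Summable.of_norm_bounded
    (hb.summable_binTerm_real (norm_nonneg y) (norm_nonneg w)) fun p => ?_
  unfold binTerm
  rw [norm_mul, norm_prod]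
  gcongr with i
  split_ifs
  · rw [norm_mul, norm_div, norm_div, norm_pow, norm_pow, RCLike.norm_natCast,
      RCLike.norm_natCast]
    gcongr <;> exact norm_le_pi_norm _ _
  · simp

/-- The coefficients of the `I`-th derivative. -/
def shift (I : Fin n → ℕ) (b : (Fin n → ℕ) → ℂ) : (Fin n → ℕ) → ℂ := fun N => b (N + I)

/-- The same double series, restricted to the pairs `I ≤ M` and reindexed by `(I, M - I)`. -/
theorem Entire.summable_shift_sum {b : (Fin n → ℕ) → ℂ} (hb : Entire b) {r s : ℝ}
    (hr : 0 ≤ r) (hs : 0 ≤ s) :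
    Summable fun p : (Fin n → ℕ) × (Fin n → ℕ) => ((mfact p.1 : ℝ)⁻¹ * s ^ deg p.1) *
      ((mfact p.2 : ℝ)⁻¹ * ‖shift p.1 b p.2‖ * r ^ deg p.2) := by
  have hinj : Function.Injective fun p : (Fin n → ℕ) × (Fin n → ℕ) => (p.2 + p.1, p.1) := by
    intro p q h
    have h1 : p.1 = q.1 := congrArg Prod.snd h
    have h2 : p.2 + p.1 = q.2 + q.1 := congrArg Prod.fst h
    rw [h1] at h2
    exact Prod.ext h1 (add_right_cancel h2)
  refine ((hb.summable_binTerm_real hr hs).comp_injective hinj).congr fun p => ?_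
  rw [Function.comp_apply, binTerm_add, prod_pow_eq_pow_deg, prod_pow_eq_pow_deg]
  rfl

theorem Entire.shift {b : (Fin n → ℕ) → ℂ} (hb : Entire b) (I : Fin n → ℕ) :
    Entire (shift I b) := by
  intro r hr
  have h := (hb.summable_shift_sum hr zero_le_one).prod_factor I
  simp only [one_pow, mul_one] at h
  exact (summable_mul_left_iff
    (inv_ne_zero (Nat.cast_ne_zero.2 (mfact_pos I).ne'))).1 h

theorem Entire.hasSum_binTerm_col {b : (Fin n → ℕ) → ℂ} (hb : Entire b) (y w : Fin n → ℂ)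
    (I : Fin n → ℕ) :
    HasSum (fun M => binTerm b y w (M, I)) (((mfact I : ℂ)⁻¹ * ∏ i, w i ^ I i) *
      expSeries (WickBF.shift I b) y) := by
  have hinj : Function.Injective fun N : Fin n → ℕ => N + I := add_left_injective I
  have hM : ∀ M ∉ Set.range fun N : Fin n → ℕ => N + I, binTerm b y w (M, I) = 0 := by
    intro M hM
    refine binTerm_eq_zero b y w fun hle => hM ⟨M - I, ?_⟩
    exact tsub_add_cancel_of_le hle
  rw [← hinj.hasSum_iff hM]
  refine (((hb.shift I).hasSum y).mul_left ((mfact I : ℂ)⁻¹ * ∏ i, w i ^ I i)).congr_fun ?_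
  intro N
  exact binTerm_add b y w N I

/-- Taylor's formula for everywhere convergent power series. -/
theorem Entire.hasSum_taylor {b : (Fin n → ℕ) → ℂ} (hb : Entire b) (y w : Fin n → ℂ) :
    HasSum (fun I : Fin n → ℕ => ((mfact I : ℂ)⁻¹ * ∏ i, w i ^ I i) *
      expSeries (WickBF.shift I b) y) (expSeries b (y + w)) := by
  have h := hb.summable_binTerm y w
  -- Rows sum to the terms of the series at `y + w`; after exchanging the two indices, the fibres
  -- are the columns, which sum to the Taylor terms.
  have e : ∑' p, binTerm b y w p = expSeries b (y + w) := by
    rw [h.tsum_prod' fun M => (hasSum_binTerm b y w M).summable]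
    exact tsum_congr fun M => (hasSum_binTerm b y w M).tsum_eq
  have h2 := ((Equiv.prodComm (Fin n → ℕ) (Fin n → ℕ)).hasSum_iff (f := binTerm b y w)).2 h.hasSum
  rw [e] at h2
  exact h2.prod_fiberwise fun I => hb.hasSum_binTerm_col y w I

end Multiindex

/-! ### Wirtinger derivatives of everywhere convergent anti-holomorphic series -/

section Derivatives

variable {n : ℕ}

theorem mfact_zero : mfact (0 : Fin n → ℕ) = 1 := by simp [mfact]

theorem mfact_single (i : Fin n) : mfact (Pi.single i 1 : Fin n → ℕ) = 1 := by
  have h := mfact_add_single (0 : Fin n → ℕ) i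
  simpa [mfact_zero] using h

theorem prod_pow_single (y : Fin n → ℂ) (i : Fin n) :
    ∏ j, y j ^ (Pi.single i 1 : Fin n → ℕ) j = y i := by
  rw [Finset.prod_eq_single i]
  · simp
  · intro j _ hj
    simp [Pi.single_eq_of_ne hj]
  · simp

theorem deg_eq_zero {N : Fin n → ℕ} : deg N = 0 ↔ N = 0 := by
  simp [deg, funext_iff]

theorem deg_eq_one {N : Fin n → ℕ} (h : deg N = 1) : ∃ i, N = Pi.single i 1 := by
  have h0 : N ≠ 0 := fun h0 => by simp [h0, deg] at h
  obtain ⟨i, hi⟩ := Function.ne_iff.1 h0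
  refine ⟨i, ?_⟩
  have hle : Pi.single i 1 ≤ N := by
    intro j
    by_cases hj : j = i
    · subst hj
      simpa [Nat.one_le_iff_ne_zero] using hi
    · simp [Pi.single_eq_of_ne hj]
  have h1 := deg_add (N - Pi.single i 1) (Pi.single i 1)
  rw [tsub_add_cancel_of_le hle, h, deg_single] at h1
  have h2 : N - Pi.single i 1 = 0 := deg_eq_zero.1 (by omega)
  rw [← tsub_add_cancel_of_le hle, h2, zero_add]

theorem shift_zero (b : (Fin n → ℕ) → ℂ) : shift 0 b = b := rfl

theorem shift_shift (I J : Fin n → ℕ) (b : (Fin n → ℕ) → ℂ) :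
    shift I (shift J b) = shift (I + J) b := by
  funext N
  simp [shift, add_assoc]

/-- In Taylor's formula every term of degree at least two is `O(‖w‖²)` for `‖w‖ ≤ 1`; the constant
is the sum of the absolute majorants `u I`, finite by `summable_shift_sum` with `s = 1`. -/
theorem Entire.exists_taylor_bound {b : (Fin n → ℕ) → ℂ} (hb : Entire b) (y : Fin n → ℂ) :
    ∃ C : ℝ, ∀ w : Fin n → ℂ, ‖w‖ ≤ 1 →
      ‖expSeries b (y + w) - expSeries b y
        - ∑ i, w i * expSeries (WickBF.shift (Pi.single i 1) b) y‖ ≤ C * ‖w‖ ^ 2 := by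
  have hs := hb.summable_shift_sum (norm_nonneg y) zero_le_one
  set u : (Fin n → ℕ) → ℝ := fun I => ∑' N : Fin n → ℕ, (mfact I : ℝ)⁻¹ * 1 ^ deg I *
    ((mfact N : ℝ)⁻¹ * ‖WickBF.shift I b N‖ * ‖y‖ ^ deg N) with hu
  have hus : Summable u := hs.prod
  have hu0 : ∀ I, 0 ≤ u I := fun I => tsum_nonneg fun N => by positivity
  refine ⟨∑' I, u I, fun w hw => ?_⟩
  set f : (Fin n → ℕ) → ℂ := fun I => ((mfact I : ℂ)⁻¹ * ∏ i, w i ^ I i) *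
      expSeries (WickBF.shift I b) y with hf
  have hfu : ∀ I, ‖f I‖ ≤ u I * ‖w‖ ^ deg I := by
    intro I
    have h1 : ‖expSeries (WickBF.shift I b) y‖
        ≤ ∑' N : Fin n → ℕ, ((mfact N : ℝ)⁻¹ * ‖WickBF.shift I b N‖ * ‖y‖ ^ deg N) := by
      refine tsum_of_norm_bounded ((hb.shift I) ‖y‖ (norm_nonneg _)).hasSum fun N => ?_
      rw [norm_mul, norm_mul, norm_inv, Complex.norm_natCast]
      gcongr
      exact norm_prod_pow_le y N
    rw [hf, hu]
    simp only [norm_mul, norm_inv, Complex.norm_natCast, one_pow, mul_one]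
    rw [tsum_mul_left, mul_assoc, mul_assoc]
    rw [mul_comm (∑' _, _)]
    gcongr
    exact norm_prod_pow_le w I
  -- The multiindices of degree zero and one, which carry the value and the differential.
  let S : Finset (Fin n → ℕ) := insert 0 (Finset.univ.image fun i => Pi.single i 1)
  have hS : ∑ I ∈ S, f I
      = expSeries b y + ∑ i, w i * expSeries (WickBF.shift (Pi.single i 1) b) y := by
    rw [Finset.sum_insert, Finset.sum_image]
    · simp only [hf, mfact_zero, mfact_single, prod_pow_single, shift_zero]
      simp
    · intro i _ j _ hij
      by_contra hne
      have := congrFun hij i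
      simp [Pi.single_eq_of_ne hne] at this
    · simp only [Finset.mem_image, Finset.mem_univ, true_and, not_exists]
      intro i hi
      have := congrFun hi i
      simp at this
  have hsum : HasSum (fun I => f I - if I ∈ S then f I else 0)
      (expSeries b (y + w) - ∑ I ∈ S, f I) := by
    refine (hb.hasSum_taylor y w).sub ?_
    have : HasSum (fun I => if I ∈ S then f I else 0) (∑ I ∈ S, if I ∈ S then f I else 0) :=
      hasSum_sum_of_ne_finset_zero fun I hI => if_neg hI
    rwa [Finset.sum_congr rfl fun I hI => if_pos hI] at this
  rw [sub_sub, ← hS, ← tsum_mul_right, ← hsum.tsum_eq]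
  refine tsum_of_norm_bounded (hus.mul_right _).hasSum fun I => ?_
  split_ifs with hI
  · simpa using mul_nonneg (hu0 I) (sq_nonneg ‖w‖)
  · rw [sub_zero]
    refine (hfu I).trans (mul_le_mul_of_nonneg_left ?_ (hu0 I))
    refine pow_le_pow_of_le_one (norm_nonneg _) hw ?_
    by_contra hlt
    apply hI
    have h2 : deg I = 0 ∨ deg I = 1 := by omega
    rcases h2 with h2 | h2
    · exact Finset.mem_insert.2 (Or.inl (deg_eq_zero.1 h2))
    · obtain ⟨i, rfl⟩ := deg_eq_one h2
      exact Finset.mem_insert.2 (Or.inr (Finset.mem_image_of_mem _ (Finset.mem_univ i)))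

/-- The differential of `expSeries b`. -/
def expSeriesDeriv (b : (Fin n → ℕ) → ℂ) (y : Fin n → ℂ) : (Fin n → ℂ) →L[ℂ] ℂ :=
  ∑ i, expSeries (shift (Pi.single i 1) b) y • ContinuousLinearMap.proj i

theorem expSeriesDeriv_apply (b : (Fin n → ℕ) → ℂ) (y v : Fin n → ℂ) :
    expSeriesDeriv b y v = ∑ i, v i * expSeries (shift (Pi.single i 1) b) y := by
  simp [expSeriesDeriv, mul_comm]

theorem Entire.hasFDerivAt {b : (Fin n → ℕ) → ℂ} (hb : Entire b) (y : Fin n → ℂ) :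
    HasFDerivAt (expSeries b) (expSeriesDeriv b y) y := by
  obtain ⟨C, hC⟩ := hb.exists_taylor_bound y
  rw [hasFDerivAt_iff_isLittleO_nhds_zero]
  have h1 : (fun w => expSeries b (y + w) - expSeries b y - expSeriesDeriv b y w)
      =O[nhds 0] fun w => ‖w‖ ^ 2 := by
    refine Asymptotics.IsBigO.of_bound C ?_
    filter_upwards [Metric.closedBall_mem_nhds (0 : Fin n → ℂ) one_pos] with w hw
    rw [expSeriesDeriv_apply, norm_pow, norm_norm]
    exact hC w (by simpa using hw)
  exact h1.trans_isLittleO (Asymptotics.isLittleO_norm_pow_id one_lt_two)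

/-- The anti-holomorphic function `∑_N (1/N!) b_N z̄^N`. -/
def antiSeries (b : (Fin n → ℕ) → ℂ) : (Fin n → ℂ) → ℂ := fun z =>
  expSeries b fun i => conj (z i)

theorem Psi_eq_antiSeries (f : (Fin n → ℂ) → ℂ) :
    Psi f = antiSeries fun N => dzbarPow N f 0 := rfl

theorem Entire.antiHol {b : (Fin n → ℕ) → ℂ} (hb : Entire b) : AntiHol (antiSeries b) := by
  have e : (fun z => antiSeries b (star z)) = expSeries b := by
    funext z
    simp [antiSeries]
  unfold AntiHol
  rw [e]
  exact fun y => (hb.hasFDerivAt y).differentiableAt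

theorem Entire.hasFDerivAt_antiSeries {b : (Fin n → ℕ) → ℂ} (hb : Entire b) (z : Fin n → ℂ) :
    HasFDerivAt (antiSeries b) (((expSeriesDeriv b fun i => conj (z i)).restrictScalars ℝ).comp
      (ContinuousLinearMap.pi fun i =>
        (Complex.conjCLE : ℂ →L[ℝ] ℂ).comp (ContinuousLinearMap.proj i))) z := by
  refine HasFDerivAt.comp z (g := expSeries b) (f := fun z i => conj (z i))
    ((hb.hasFDerivAt _).restrictScalars ℝ) ?_
  exact (ContinuousLinearMap.pi fun i =>
        (Complex.conjCLE : ℂ →L[ℝ] ℂ).comp (ContinuousLinearMap.proj i)).hasFDerivAt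

theorem Entire.fderiv_antiSeries {b : (Fin n → ℕ) → ℂ} (hb : Entire b) (z v : Fin n → ℂ) :
    fderiv ℝ (antiSeries b) z v
      = ∑ i, conj (v i) * antiSeries (WickBF.shift (Pi.single i 1) b) z := by
  rw [(hb.hasFDerivAt_antiSeries z).fderiv]
  exact expSeriesDeriv_apply _ _ _

theorem Entire.fderiv_antiSeries_single {b : (Fin n → ℕ) → ℂ} (hb : Entire b) (z : Fin n → ℂ)
    (i : Fin n) (c : ℂ) :
    fderiv ℝ (antiSeries b) z (Pi.single i c)
      = conj c * antiSeries (WickBF.shift (Pi.single i 1) b) z := by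
  rw [hb.fderiv_antiSeries, Finset.sum_eq_single i]
  · simp
  · intro j _ hj
    simp [Pi.single_eq_of_ne hj]
  · simp

/-- The real differential is conjugate-linear, so the contributions along `1` and `I` add up in
`∂/∂z̄` and cancel in `∂/∂z`. -/
theorem Entire.dzbar_antiSeries {b : (Fin n → ℕ) → ℂ} (hb : Entire b) (i : Fin n) :
    dzbar i (antiSeries b) = antiSeries (WickBF.shift (Pi.single i 1) b) := by
  funext z
  simp only [dzbar, hb.fderiv_antiSeries_single, map_one, Complex.conj_I]
  linear_combination (-1 / 2 * antiSeries (WickBF.shift (Pi.single i 1) b) z) * Complex.I_mul_I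

theorem Entire.dz_antiSeries {b : (Fin n → ℕ) → ℂ} (hb : Entire b) (i : Fin n) :
    dz i (antiSeries b) = 0 := by
  funext z
  simp only [dz, hb.fderiv_antiSeries_single, map_one, Complex.conj_I, Pi.zero_apply]
  linear_combination (1 / 2 * antiSeries (WickBF.shift (Pi.single i 1) b) z) * Complex.I_mul_I

theorem Entire.dzbar_iterate_antiSeries {b : (Fin n → ℕ) → ℂ} (hb : Entire b) (i : Fin n) (k : ℕ) :
    (dzbar i)^[k] (antiSeries b) = antiSeries (WickBF.shift (Pi.single i k) b) := by
  induction k with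
  | zero => simp [shift_zero]
  | succ k ih =>
    rw [Function.iterate_succ_apply', ih, (hb.shift _).dzbar_antiSeries, shift_shift,
      ← Pi.single_add, add_comm]

theorem Entire.dzbarPow_antiSeries {b : (Fin n → ℕ) → ℂ} (hb : Entire b) (S : Fin n → ℕ) :
    dzbarPow S (antiSeries b) = antiSeries (WickBF.shift S b) := by
  have key : ∀ l : List (Fin n), l.foldr (fun i g => (dzbar i)^[S i] g) (antiSeries b)
      = antiSeries (WickBF.shift (l.map fun i => Pi.single i (S i)).sum b) := by
    intro l
    induction l with
    | nil => rfl
    | cons i l ih =>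
      rw [List.foldr_cons, ih, (hb.shift _).dzbar_iterate_antiSeries, shift_shift, List.map_cons,
        List.sum_cons]
  unfold dzbarPow
  rw [key, ← List.ofFn_eq_map, List.sum_ofFn, Finset.univ_sum_single]

theorem dz_zero (i : Fin n) : dz i (0 : (Fin n → ℂ) → ℂ) = 0 := by
  funext z
  simp [dz]

theorem Entire.dzPow_antiSeries {b : (Fin n → ℕ) → ℂ} (hb : Entire b) {R : Fin n → ℕ}
    (hR : R ≠ 0) : dzPow R (antiSeries b) = 0 := by
  -- The first nonzero exponent met by the fold yields the zero function, which all further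
  -- derivatives fix.
  have key : ∀ l : List (Fin n), l.foldr (fun i g => (dz i)^[R i] g) (antiSeries b)
      = if ∀ i ∈ l, R i = 0 then antiSeries b else 0 := by
    intro l
    induction l with
    | nil => simp
    | cons i l ih =>
      have hz : ∀ k, (dz i)^[k] (0 : (Fin n → ℂ) → ℂ) = 0 := fun k =>
        Function.iterate_fixed (dz_zero i) k
      rw [List.foldr_cons, ih]
      rcases Nat.eq_zero_or_pos (R i) with h | h
      · simp [h]
      · rw [if_neg fun hall : ∀ j ∈ i :: l, R j = 0 => h.ne' (hall i List.mem_cons_self)]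
        obtain ⟨k, hk⟩ := Nat.exists_eq_succ_of_ne_zero h.ne'
        split_ifs
        · rw [hk, Function.iterate_succ_apply, hb.dz_antiSeries, hz]
        · exact hz _
  unfold dzPow
  rw [key, if_neg]
  intro h
  exact hR (funext fun i => h i (List.mem_finRange i))

theorem expSeries_zero (b : (Fin n → ℕ) → ℂ) : expSeries b 0 = b 0 := by
  unfold expSeries
  rw [tsum_eq_single 0]
  · simp [mfact_zero]
  · intro N hN
    obtain ⟨i, hi⟩ := Function.ne_iff.1 hN
    rw [Finset.prod_eq_zero (Finset.mem_univ i) (zero_pow hi), mul_zero]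

theorem antiSeries_zero (b : (Fin n → ℕ) → ℂ) : antiSeries b 0 = b 0 := by
  rw [← expSeries_zero b]
  unfold antiSeries
  congr 1
  funext i
  simp

end Derivatives

/-! ### Gaussian moments, orthonormal monomials and the mean value property -/

section Gaussian

variable {n : ℕ} {hbar : ℝ}

/-- The one-variable Gaussian moment integrand. -/
def gaussMoment (hbar : ℝ) (a b : ℕ) (z : ℂ) : ℂ :=
  (((2 * Real.pi * hbar)⁻¹ * Real.exp (-‖z‖ ^ 2 / (2 * hbar)) : ℝ) : ℂ) * (z ^ a * conj z ^ b)

theorem gauss_radial_integral (hh : 0 < hbar) (k : ℕ) :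
    ∫ z : ℂ, ‖z‖ ^ k * Real.exp (-‖z‖ ^ 2 / (2 * hbar))
      = Real.pi * (2 * hbar)⁻¹ ^ (-((k : ℝ) + 2) / 2) * Real.Gamma (((k : ℝ) + 2) / 2) := by
  have h := Complex.integral_rpow_mul_exp_neg_mul_rpow (p := 2) (q := k) (b := (2 * hbar)⁻¹)
    one_le_two (by have : (0 : ℝ) ≤ k := Nat.cast_nonneg k; linarith) (by positivity)
  rw [show 2 * Real.pi / 2 = Real.pi by ring] at h
  rw [← h]
  congr 1
  funext z
  rw [Real.rpow_natCast, show (2 : ℝ) = ((2 : ℕ) : ℝ) by norm_num, Real.rpow_natCast]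
  congr 2
  push_cast
  ring

/-- A function that is not integrable has integral `0` by convention, whereas the value computed
above is positive. -/
theorem gauss_radial_integrable (hh : 0 < hbar) (k : ℕ) :
    Integrable fun z : ℂ => ‖z‖ ^ k * Real.exp (-‖z‖ ^ 2 / (2 * hbar)) := by
  by_contra h
  have h0 := integral_undef h
  rw [gauss_radial_integral hh] at h0
  have h1 : 0 < Real.Gamma (((k : ℝ) + 2) / 2) := Real.Gamma_pos_of_pos (by positivity)
  have h2 : 0 < (2 * hbar)⁻¹ ^ (-((k : ℝ) + 2) / 2) := Real.rpow_pos_of_pos (by positivity) _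
  have := Real.pi_pos
  exact absurd h0 (by positivity)

theorem gaussMoment_integrable (hh : 0 < hbar) (a b : ℕ) : Integrable (gaussMoment hbar a b) := by
  have hc : Continuous (gaussMoment hbar a b) := by
    unfold gaussMoment
    fun_prop
  refine (((gauss_radial_integrable hh (a + b)).const_mul (2 * Real.pi * hbar)⁻¹).mono'
    hc.aestronglyMeasurable (Filter.Eventually.of_forall fun z => ?_))
  unfold gaussMoment
  have := Real.pi_pos
  rw [norm_mul, norm_mul, norm_pow, norm_pow, Complex.norm_real, Real.norm_of_nonneg (by positivity),
    RCLike.norm_conj, pow_add]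
  apply le_of_eq
  ring

theorem gaussMoment_integral_self (hh : 0 < hbar) (a : ℕ) :
    ∫ z, gaussMoment hbar a a z = ((a.factorial * (2 * hbar) ^ a : ℝ) : ℂ) := by
  have e : gaussMoment hbar a a = fun z => (((2 * Real.pi * hbar)⁻¹ *
      (‖z‖ ^ (2 * a) * Real.exp (-‖z‖ ^ 2 / (2 * hbar))) : ℝ) : ℂ) := by
    funext z
    unfold gaussMoment
    rw [← mul_pow, Complex.mul_conj']
    push_cast
    ring
  rw [e, integral_complex_ofReal, integral_const_mul, gauss_radial_integral hh]
  congr 1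
  have h1 : (((2 * a : ℕ) : ℝ) + 2) / 2 = a + 1 := by push_cast; ring
  rw [neg_div, h1, Real.Gamma_nat_eq_factorial, Real.rpow_neg (by positivity),
    Real.inv_rpow (by positivity), inv_inv, Real.rpow_add_one (by positivity), Real.rpow_natCast]
  have := Real.pi_pos.ne'
  field_simp

/-- The rotation by the angle `π / (a - b)` preserves Lebesgue measure and changes the sign of the
integrand, so the integral equals its own negative. -/
theorem gaussMoment_integral_of_ne {a b : ℕ} (hab : a ≠ b) : ∫ z, gaussMoment hbar a b z = 0 := by
  set t : ℝ := Real.pi / ((a : ℝ) - b) with ht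
  have hab' : (a : ℝ) - b ≠ 0 := sub_ne_zero.2 (Nat.cast_injective.ne hab)
  have hl : ((Circle.exp t : ℂ)) ^ a * conj (Circle.exp t : ℂ) ^ b = -1 := by
    rw [Circle.coe_exp, ← Complex.exp_conj, ← Complex.exp_nat_mul, ← Complex.exp_nat_mul,
      ← Complex.exp_add, ← Complex.exp_pi_mul_I]
    congr 1
    simp only [map_mul, Complex.conj_ofReal, Complex.conj_I]
    have h2 : ((a : ℂ) - b) * t = Real.pi := by
      rw [ht]
      have : ((a : ℂ) - b) ≠ 0 := by exact_mod_cast hab'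
      push_cast
      field_simp
    linear_combination Complex.I * h2
  have h := (rotation (Circle.exp t)).measurePreserving.integral_comp
    (rotation (Circle.exp t)).toHomeomorph.measurableEmbedding (gaussMoment hbar a b)
  have e : ∀ z, gaussMoment hbar a b (rotation (Circle.exp t) z) = -gaussMoment hbar a b z := by
    intro z
    unfold gaussMoment
    rw [LinearIsometryEquiv.norm_map, rotation_apply, map_mul, mul_pow, mul_pow]
    linear_combination ((((2 * Real.pi * hbar)⁻¹ * Real.exp (-‖z‖ ^ 2 / (2 * hbar)) : ℝ) : ℂ) *
      (z ^ a * conj z ^ b)) * hl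
  simp only [e, integral_neg] at h
  exact self_eq_neg.1 h.symm

theorem rho_eq_prod (z : Fin n → ℂ) :
    rho n hbar z = ∏ i, ((2 * Real.pi * hbar)⁻¹ * Real.exp (-‖z i‖ ^ 2 / (2 * hbar))) := by
  rw [Finset.prod_mul_distrib, ← Real.exp_sum, Finset.prod_const, Finset.card_univ,
    Fintype.card_fin, ← Finset.sum_div, Finset.sum_neg_distrib, inv_pow]
  rfl

theorem rho_smul_monomials (M N : Fin n → ℕ) (z : Fin n → ℂ) :
    rho n hbar z • ((∏ i, z i ^ M i) * ∏ i, conj (z i) ^ N i)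
      = ∏ i, gaussMoment hbar (M i) (N i) (z i) := by
  unfold gaussMoment
  rw [Finset.prod_mul_distrib, Finset.prod_mul_distrib, Complex.real_smul, rho_eq_prod,
    Complex.ofReal_prod]

theorem integrable_monomials (hh : 0 < hbar) (M N : Fin n → ℕ) :
    Integrable fun z : Fin n → ℂ =>
      rho n hbar z • ((∏ i, z i ^ M i) * ∏ i, conj (z i) ^ N i) := by
  simp_rw [rho_smul_monomials]
  exact Integrable.fintype_prod_dep fun i => gaussMoment_integrable hh (M i) (N i)

theorem integral_monomials (hh : 0 < hbar) (M N : Fin n → ℕ) :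
    ∫ z : Fin n → ℂ, rho n hbar z • ((∏ i, z i ^ M i) * ∏ i, conj (z i) ^ N i)
      = if M = N then ((mfact N * (2 * hbar) ^ deg N : ℝ) : ℂ) else 0 := by
  simp_rw [rho_smul_monomials]
  rw [integral_fintype_prod_volume_eq_prod fun i => gaussMoment hbar (M i) (N i)]
  split_ifs with h
  · subst h
    simp_rw [gaussMoment_integral_self hh]
    rw [← Complex.ofReal_prod, Finset.prod_mul_distrib, prod_pow_eq_pow_deg, mfact, Nat.cast_prod]
  · obtain ⟨i, hi⟩ := Function.ne_iff.1 h
    exact Finset.prod_eq_zero (Finset.mem_univ i) (gaussMoment_integral_of_ne hi)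

/-- The norm of `∂z̄^N` at the origin on the Bargmann-Fock space. -/
def kap (hbar : ℝ) (N : Fin n → ℕ) : ℝ := √(mfact N / (2 * hbar) ^ deg N)

theorem kap_pos (hh : 0 < hbar) (N : Fin n → ℕ) : 0 < kap hbar N := by
  have := mfact_pos N
  unfold kap
  positivity

theorem kap_sq (hh : 0 < hbar) (N : Fin n → ℕ) :
    kap hbar N ^ 2 = mfact N / (2 * hbar) ^ deg N := by
  unfold kap
  rw [Real.sq_sqrt (by positivity)]

/-- The normalized anti-holomorphic monomials. -/
def monoFn (hbar : ℝ) (N : Fin n → ℕ) : (Fin n → ℂ) → ℂ := fun z =>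
  (((mfact N : ℝ)⁻¹ * kap hbar N : ℝ) : ℂ) * ∏ i, conj (z i) ^ N i

theorem monoFn_continuous (N : Fin n → ℕ) : Continuous (monoFn hbar N) := by
  unfold monoFn
  fun_prop

theorem monoFn_antiHol (N : Fin n → ℕ) : AntiHol (monoFn hbar N) := by
  unfold AntiHol monoFn
  simp only [Pi.star_apply, RCLike.star_def, Complex.conj_conj]
  fun_prop

theorem rho_smul_monoFn (M N : Fin n → ℕ) (z : Fin n → ℂ) :
    rho n hbar z • (conj (monoFn hbar M z) * monoFn hbar N z)
      = ((((mfact M : ℝ)⁻¹ * kap hbar M) * ((mfact N : ℝ)⁻¹ * kap hbar N) : ℝ) : ℂ) *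
        (rho n hbar z • ((∏ i, z i ^ M i) * ∏ i, conj (z i) ^ N i)) := by
  unfold monoFn
  simp only [Complex.real_smul, map_mul, map_prod, map_pow, Complex.conj_conj, Complex.conj_ofReal]
  push_cast
  ring

theorem monoFn_mem (hbar : ℝ) [hh : Fact (0 < hbar)] (N : Fin n → ℕ) :
    monoFn hbar N ∈ bfSpace n hbar := by
  refine ⟨monoFn_antiHol N, ?_⟩
  rw [memLp_two_iff_integrable_sq_norm (monoFn_continuous N).aestronglyMeasurable,
    gaussian_integrable]
  have h := ((integrable_monomials (n := n) hh.out N N).const_mul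
    ((((mfact N : ℝ)⁻¹ * kap hbar N) * ((mfact N : ℝ)⁻¹ * kap hbar N) : ℝ) : ℂ)).norm
  simp_rw [← rho_smul_monoFn] at h
  refine h.congr (Filter.Eventually.of_forall fun z => ?_)
  simp only [norm_smul, norm_mul, RCLike.norm_conj, Real.norm_of_nonneg (rho_pos n hbar z).le]
  rw [smul_eq_mul]
  ring

/-- The normalized monomials as elements of the Bargmann-Fock space. -/
def mono (hbar : ℝ) [Fact (0 < hbar)] (N : Fin n → ℕ) : HBF n hbar :=
  ⟨monoFn hbar N, monoFn_mem hbar N⟩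

theorem HBF.inner_eq [Fact (0 < hbar)] (φ ψ : HBF n hbar) :
    inner ℂ φ ψ = ∫ z, rho n hbar z • (conj (φ z) * ψ z) :=
  gaussian_integral n hbar _

theorem orthonormal_mono (n : ℕ) (hbar : ℝ) [hh : Fact (0 < hbar)] :
    Orthonormal ℂ (mono (n := n) hbar) := by
  classical
  rw [orthonormal_iff_ite]
  intro M N
  rw [HBF.inner_eq]
  change ∫ z, rho n hbar z • (conj (monoFn hbar M z) * monoFn hbar N z) = _
  simp_rw [rho_smul_monoFn]
  rw [integral_const_mul, integral_monomials hh.out]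
  split_ifs with h
  · subst h
    rw [← Complex.ofReal_mul]
    norm_cast
    have h1 := kap_sq hh.out M
    have h2 : (mfact M : ℝ) ≠ 0 := Nat.cast_ne_zero.2 (mfact_pos M).ne'
    have h3 : (2 * hbar) ^ deg M ≠ 0 := pow_ne_zero _ (mul_pos two_pos hh.out).ne'
    rw [eq_div_iff h3] at h1
    field_simp
    linear_combination h1
  · rw [mul_zero]

theorem measurePreserving_smul_of_norm_one {c : ℂ} (hc : ‖c‖ = 1) :
    MeasurePreserving (fun z : Fin n → ℂ => c • z) volume volume := by
  let a : Circle := ⟨c, by simp [Submonoid.unitSphere, hc]⟩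
  exact volume_preserving_pi (f := fun (_ : Fin n) (x : ℂ) => c * x)
    fun _ => (rotation a).measurePreserving

theorem rho_smul_of_norm_one {c : ℂ} (hc : ‖c‖ = 1) (z : Fin n → ℂ) :
    rho n hbar (c • z) = rho n hbar z := by
  simp [rho, hc]

theorem integral_rho (hh : 0 < hbar) : ∫ z, ((rho n hbar z : ℝ) : ℂ) = 1 := by
  have h := integral_monomials (n := n) hh 0 0
  simpa [mfact_zero, deg] using h

theorem integrable_rho_smul [Fact (0 < hbar)] (ψ : HBF n hbar) :
    Integrable fun z => rho n hbar z • ψ z := by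
  have h := integrable_inner (mono hbar 0) ψ
  unfold gaussian at h
  rw [integrable_withDensity_iff_integrable_smul'
    ((rho_continuous n hbar).measurable.ennreal_ofReal) (by simp)] at h
  simp only [ENNReal.toReal_ofReal (rho_pos n hbar _).le] at h
  refine h.congr (Filter.Eventually.of_forall fun z => ?_)
  change rho n hbar z • (conj (monoFn hbar 0 z) * ψ z) = _
  simp [monoFn, kap, mfact_zero, deg]

/-- The conjugated circle parameter makes the integrand holomorphic in that parameter, so the mean
value property on the unit circle applies. -/
theorem circle_mean {ψ : (Fin n → ℂ) → ℂ} (h : AntiHol ψ) (z : Fin n → ℂ) :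
    ∫ t in (0 : ℝ)..2 * Real.pi, ψ (conj (circleMap 0 1 t) • z) = 2 * Real.pi * ψ 0 := by
  have hd : Differentiable ℂ fun c : ℂ => (fun y => ψ (star y)) (c • star z) :=
    Differentiable.comp (g := fun y => ψ (star y)) h (by fun_prop)
  have h1 := (hd.diffContOnCl (s := Metric.ball 0 |1|)).circleAverage
  rw [Real.circleAverage_def, inv_smul_eq_iff₀ (by positivity)] at h1
  simpa using h1

/-- The mean value property with respect to the Gaussian measure. -/
theorem integral_rho_smul_antiHol [hh : Fact (0 < hbar)] (ψ : HBF n hbar) :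
    ∫ z, rho n hbar z • ψ z = ψ 0 := by
  have hI := integrable_rho_smul ψ
  have hc : Continuous ψ.fn := ψ.mem.1.continuous
  have hn : ∀ t : ℝ, ‖conj (circleMap 0 1 t)‖ = 1 := fun t => by simp
  have hemb : ∀ t : ℝ, MeasurableEmbedding fun z : Fin n → ℂ => conj (circleMap 0 1 t) • z :=
    fun t => (Homeomorph.smulOfNeZero _ (norm_ne_zero_iff.1 ((hn t).trans_ne one_ne_zero))
      ).measurableEmbedding
  -- Rotations `z ↦ c z` with `|c| = 1` preserve the Gaussian weight, so the integral may be
  -- averaged over the circle; exchanging the integrals replaces `ψ` by its circular means, all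
  -- equal to `ψ 0`.
  have hrot : ∀ t : ℝ, ∫ z, rho n hbar z • ψ (conj (circleMap 0 1 t) • z)
      = ∫ z, rho n hbar z • ψ z := by
    intro t
    rw [← (measurePreserving_smul_of_norm_one (hn t)).integral_comp (hemb t)
      (fun z => rho n hbar z • ψ z)]
    simp_rw [rho_smul_of_norm_one (hn t)]
  have hrotI : ∀ t : ℝ, Integrable fun z => rho n hbar z • ψ (conj (circleMap 0 1 t) • z) := by
    intro t
    have := ((measurePreserving_smul_of_norm_one (n := n) (hn t)).integrable_comp_emb
      (hemb t)).2 hI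
    refine this.congr (Filter.Eventually.of_forall fun z => ?_)
    simp only [Function.comp_apply, rho_smul_of_norm_one (hn t)]
  have hrotN : ∀ t : ℝ, ∫ z, ‖rho n hbar z • ψ (conj (circleMap 0 1 t) • z)‖
      = ∫ z, ‖rho n hbar z • ψ z‖ := by
    intro t
    rw [← (measurePreserving_smul_of_norm_one (hn t)).integral_comp (hemb t)
      (fun z => ‖rho n hbar z • ψ z‖)]
    simp_rw [rho_smul_of_norm_one (hn t)]
  have hcont : Continuous fun p : ℝ × (Fin n → ℂ) =>
      rho n hbar p.2 • ψ (conj (circleMap 0 1 p.1) • p.2) := by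
    have h1 : Continuous fun p : ℝ × (Fin n → ℂ) => conj (circleMap 0 1 p.1) :=
      Complex.continuous_conj.comp ((continuous_circleMap 0 1).comp continuous_fst)
    exact ((rho_continuous n hbar).comp continuous_snd).smul (hc.comp (h1.smul continuous_snd))
  -- Joint integrability holds because the integral of the norm over `z` does not depend on `t`, and
  -- the range of `t` has finite measure.
  have hprod : Integrable (Function.uncurry fun (t : ℝ) (z : Fin n → ℂ) =>
      rho n hbar z • ψ (conj (circleMap 0 1 t) • z))
      ((volume.restrict (Set.Ioc 0 (2 * Real.pi))).prod volume) := by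
    refine (integrable_prod_iff hcont.aestronglyMeasurable).2 ⟨Filter.Eventually.of_forall hrotI, ?_⟩
    simp only [hrotN]
    exact integrable_const _
  have hswap := integral_integral_swap hprod
  simp only [hrot] at hswap
  have hpi : (0 : ℝ) ≤ 2 * Real.pi := by positivity
  have hin : ∀ z : Fin n → ℂ, ∫ t in Set.Ioc 0 (2 * Real.pi),
      rho n hbar z • ψ (conj (circleMap 0 1 t) • z)
      = ((rho n hbar z : ℝ) : ℂ) * (2 * Real.pi * ψ 0) := by
    intro z
    rw [integral_smul, ← intervalIntegral.integral_of_le hpi, circle_mean ψ.mem.1,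
      Complex.real_smul]
  simp only [hin] at hswap
  rw [integral_mul_const, integral_rho hh.out, one_mul, ← intervalIntegral.integral_of_le hpi,
    intervalIntegral.integral_const, sub_zero, Complex.real_smul] at hswap
  push_cast at hswap
  have h2 : (2 * (Real.pi : ℂ)) ≠ 0 := by exact_mod_cast Real.two_pi_pos.ne'
  exact mul_left_cancel₀ h2 hswap

/-- The zeroth monomial is the constant `1`, so the mean value property is the reproducing property
at the origin. -/
theorem inner_mono_zero [Fact (0 < hbar)] (ψ : HBF n hbar) :
    inner ℂ (mono hbar 0) ψ = ψ 0 := by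
  rw [HBF.inner_eq, ← integral_rho_smul_antiHol]
  congr 1
  funext z
  change rho n hbar z • (conj (monoFn hbar 0 z) * ψ z) = _
  simp [monoFn, kap, mfact_zero, deg]

end Gaussian

/-! ### The Bargmann-Fock space as a weighted ℓ² space of Taylor coefficients -/

section HilbertSpace

variable {n : ℕ} {hbar : ℝ}

/-- The linear map sending an element of the Bargmann-Fock space to the underlying function. -/
def HBF.fnLin (n : ℕ) (hbar : ℝ) : HBF n hbar →ₗ[ℂ] ((Fin n → ℂ) → ℂ) :=
  (bfSpace n hbar).subtype

theorem HBF.fn_smul (c : ℂ) (ψ : HBF n hbar) : (c • ψ).fn = c • ψ.fn := rfl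

theorem HBF.fn_sum {ι : Type*} (s : Finset ι) (ψ : ι → HBF n hbar) :
    (∑ i ∈ s, ψ i).fn = ∑ i ∈ s, (ψ i).fn :=
  map_sum (HBF.fnLin n hbar) ψ s

theorem HBF.eLpNorm_eq [Fact (0 < hbar)] (ψ : HBF n hbar) :
    eLpNorm ψ.fn 2 (gaussian n hbar) = ENNReal.ofReal ‖ψ‖ := by
  rw [ψ.mem.2.eLpNorm_eq_integral_rpow_norm two_ne_zero (by simp)]
  congr 1
  have h1 : ∫ z, ‖ψ z‖ ^ (2 : ℝ≥0∞).toReal ∂(gaussian n hbar) = ‖ψ‖ ^ 2 := by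
    rw [bf_norm_sq]
    unfold gaussian
    rw [integral_withDensity_eq_integral_toReal_smul
      ((rho_continuous n hbar).measurable.ennreal_ofReal) (by simp)]
    simp [ENNReal.toReal_ofReal (rho_pos n hbar _).le]
  rw [h1, ENNReal.toReal_ofNat]
  exact Real.pow_rpow_inv_natCast (norm_nonneg _) two_ne_zero

/-- A product is at most the sum of the squares of its factors: `‖x N‖²` is summable by hypothesis,
and the square of the other factor is a term of the exponential series at `r² / 2ħ`. -/
theorem entire_kap_mul (hh : 0 < hbar) {x : (Fin n → ℕ) → ℂ}
    (hx : Summable fun N => ‖x N‖ ^ 2) : Entire fun N => kap hbar N * x N := by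
  intro r hr
  refine (hx.add (summable_pow_deg_div_mfact (n := n) (r ^ 2 / (2 * hbar)))).of_nonneg_of_le
    (fun N => by positivity) fun N => ?_
  have h1 : ((mfact N : ℝ)⁻¹ * kap hbar N * r ^ deg N) ^ 2
      = (mfact N : ℝ)⁻¹ * (r ^ 2 / (2 * hbar)) ^ deg N := by
    rw [mul_pow, mul_pow, kap_sq hh, div_pow, ← pow_mul, ← pow_mul, mul_comm 2 (deg N)]
    have : (mfact N : ℝ) ≠ 0 := Nat.cast_ne_zero.2 (mfact_pos N).ne'
    field_simp
  rw [← h1, norm_mul, Complex.norm_real, Real.norm_of_nonneg (kap_pos hh N).le]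
  nlinarith [sq_nonneg (‖x N‖ - (mfact N : ℝ)⁻¹ * kap hbar N * r ^ deg N), sq_nonneg (‖x N‖),
    sq_nonneg ((mfact N : ℝ)⁻¹ * kap hbar N * r ^ deg N)]

theorem hasSum_monoFn (hh : 0 < hbar) {x : (Fin n → ℕ) → ℂ}
    (hx : Summable fun N => ‖x N‖ ^ 2) (z : Fin n → ℂ) :
    HasSum (fun N => x N * monoFn hbar N z) (antiSeries (fun N => kap hbar N * x N) z) := by
  refine ((entire_kap_mul hh hx).hasSum fun i => conj (z i)).congr_fun fun N => ?_
  unfold monoFn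
  push_cast
  ring

theorem norm_sum_smul_mono_sq [Fact (0 < hbar)] (x : (Fin n → ℕ) → ℂ)
    (s : Finset (Fin n → ℕ)) :
    ‖∑ N ∈ s, x N • mono hbar N‖ ^ 2 = ∑ N ∈ s, ‖x N‖ ^ 2 := by
  have h := (orthonormal_mono n hbar).inner_sum x x s
  rw [inner_self_eq_norm_sq_to_K] at h
  apply Complex.ofReal_injective
  push_cast
  refine h.trans (Finset.sum_congr rfl fun N _ => ?_)
  exact Complex.conj_mul' _

/-- Completeness of the Bargmann-Fock space is only a consequence of this estimate, so the norm of
the limit is controlled by Fatou's lemma: the partial sums converge pointwise and their norms are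
given by orthonormality. -/
theorem antiSeries_eLpNorm_le [hh : Fact (0 < hbar)] {x : (Fin n → ℕ) → ℂ}
    (hx : Summable fun N => ‖x N‖ ^ 2) :
    eLpNorm (antiSeries fun N => kap hbar N * x N) 2 (gaussian n hbar)
      ≤ ENNReal.ofReal √(∑' N, ‖x N‖ ^ 2) := by
  -- Fatou's lemma needs a sequence; the boxes `[0, k]^n` exhaust the multiindices.
  let s : ℕ → Finset (Fin n → ℕ) := fun k => Finset.Icc 0 fun _ => k
  have hs : Filter.Tendsto s Filter.atTop Filter.atTop := by
    refine Monotone.tendsto_atTop_finset (fun k l hkl => ?_) fun N => ⟨deg N, ?_⟩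
    · exact Finset.Icc_subset_Icc le_rfl fun _ => hkl
    · exact Finset.mem_Icc.2 ⟨zero_le, fun i =>
        Finset.single_le_sum (f := N) (fun _ _ => Nat.zero_le _) (Finset.mem_univ i)⟩
  let P : ℕ → HBF n hbar := fun k => ∑ N ∈ s k, x N • mono hbar N
  have hP : ∀ k z, (P k).fn z = ∑ N ∈ s k, x N * monoFn hbar N z := by
    intro k z
    rw [HBF.fn_sum, Finset.sum_apply]
    rfl
  refine (Lp.eLpNorm_lim_le_liminf_eLpNorm (f := fun k => (P k).fn)
    (fun k => (P k).mem.2.1) _ (Filter.Eventually.of_forall fun z => ?_)).trans ?_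
  · simp only [hP]
    exact (hasSum_monoFn hh.out hx z).comp hs
  · refine Filter.liminf_le_of_le ?_ fun b hb => ?_
    · isBoundedDefault
    · obtain ⟨k, hk⟩ := hb.exists
      refine hk.trans ?_
      rw [HBF.eLpNorm_eq]
      refine ENNReal.ofReal_le_ofReal (Real.le_sqrt_of_sq_le ?_)
      rw [norm_sum_smul_mono_sq]
      exact hx.sum_le_tsum _ fun _ _ => sq_nonneg _

theorem antiSeries_mem [hh : Fact (0 < hbar)] {x : (Fin n → ℕ) → ℂ}
    (hx : Summable fun N => ‖x N‖ ^ 2) :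
    antiSeries (fun N => kap hbar N * x N) ∈ bfSpace n hbar := by
  have h := (entire_kap_mul hh.out hx).antiHol
  exact ⟨h, h.continuous.aestronglyMeasurable,
    (antiSeries_eLpNorm_le hx).trans_lt ENNReal.ofReal_lt_top⟩

/-- The square-summable multiindex families. -/
abbrev Coeff (n : ℕ) : Type := lp (fun _ : Fin n → ℕ => ℂ) 2

theorem Coeff.summable (x : Coeff n) : Summable fun N => ‖x N‖ ^ 2 := by
  have h := (lp.memℓp x).summable (by simp)
  simpa using h

theorem Coeff.norm_sq (x : Coeff n) : ‖x‖ ^ 2 = ∑' N, ‖x N‖ ^ 2 := by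
  have h := lp.norm_rpow_eq_tsum (p := 2) (by simp) x
  simpa using h

theorem synthLin_aux [hh : Fact (0 < hbar)] (x : Coeff n) (z : Fin n → ℂ) :
    HasSum (fun N => x N * monoFn hbar N z) (antiSeries (fun N => kap hbar N * x N) z) :=
  hasSum_monoFn hh.out x.summable z

/-- The synthesis operator `x ↦ ∑_N x_N ê_N`. -/
def synth (n : ℕ) (hbar : ℝ) [hh : Fact (0 < hbar)] : Coeff n →L[ℂ] HBF n hbar :=
  LinearMap.mkContinuous
    { toFun := fun x => ⟨antiSeries fun N => kap hbar N * x N, antiSeries_mem x.summable⟩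
      map_add' := fun x y => by
        apply HBF.ext'
        funext z
        refine (synthLin_aux (x + y) z).unique
          (((synthLin_aux x z).add (synthLin_aux y z)).congr_fun fun N => ?_)
        exact add_mul _ _ _
      map_smul' := fun c x => by
        apply HBF.ext'
        funext z
        refine (synthLin_aux (c • x) z).unique
          (((synthLin_aux x z).mul_left c).congr_fun fun N => ?_)
        exact mul_assoc _ _ _ } 1 fun x => by
      have h := antiSeries_eLpNorm_le (hbar := hbar) x.summable
      rw [← Coeff.norm_sq, Real.sqrt_sq (norm_nonneg _)] at h
      have h2 := HBF.eLpNorm_eq (hbar := hbar)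
        ⟨antiSeries fun N => kap hbar N * x N, antiSeries_mem x.summable⟩
      rw [one_mul]
      exact (ENNReal.ofReal_le_ofReal_iff (norm_nonneg _)).1 (h2 ▸ h)

theorem synth_fn [Fact (0 < hbar)] (x : Coeff n) :
    (synth n hbar x).fn = antiSeries fun N => kap hbar N * x N := rfl

theorem synth_single [Fact (0 < hbar)] (N : Fin n → ℕ) (c : ℂ) :
    synth n hbar (lp.single 2 N c) = c • mono hbar N := by
  apply HBF.ext'
  funext z
  refine (synthLin_aux _ z).unique ?_
  convert hasSum_single N ?_ using 1
  · rw [lp.single_apply_self]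
    rfl
  · intro M hM
    rw [lp.single_apply_ne _ _ _ hM, zero_mul]

theorem hasSum_synth [Fact (0 < hbar)] (x : Coeff n) :
    HasSum (fun N => x N • mono hbar N) (synth n hbar x) := by
  simpa only [Function.comp_def, synth_single] using
    (lp.hasSum_single (by simp) x).mapL (synth n hbar)

theorem inner_mono_synth [Fact (0 < hbar)] (N : Fin n → ℕ) (x : Coeff n) :
    inner ℂ (mono hbar N) (synth n hbar x) = x N := by
  classical
  have h := (hasSum_synth (hbar := hbar) x).mapL (innerSL ℂ (mono hbar N))
  refine h.unique ?_
  convert hasSum_single N ?_ using 1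
  · simp [(orthonormal_mono n hbar).1 N]
  · intro M hM
    simp [(orthonormal_iff_ite.1 (orthonormal_mono n hbar)), hM.symm]

/-- One inequality is the Fatou bound, the other is Bessel's inequality for the monomials. -/
theorem norm_synth [Fact (0 < hbar)] (x : Coeff n) : ‖synth n hbar x‖ = ‖x‖ := by
  refine le_antisymm ?_ ?_
  · have h := (synth n hbar).le_of_opNorm_le (LinearMap.mkContinuous_norm_le _ zero_le_one _) x
    simpa using h
  · have h := (orthonormal_mono n hbar).tsum_inner_products_le (synth n hbar x)
    simp only [inner_mono_synth] at h
    rw [← Coeff.norm_sq] at h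
    exact (sq_le_sq₀ (norm_nonneg _) (norm_nonneg _)).1 h

/-- The synthesis operator as a linear isometry. -/
def synthIso (n : ℕ) (hbar : ℝ) [Fact (0 < hbar)] : Coeff n →ₗᵢ[ℂ] HBF n hbar where
  toLinearMap := (synth n hbar).toLinearMap
  norm_map' := norm_synth

/-- Weighted square-summability of the Taylor coefficients of an anti-holomorphic function. -/
def SqSummable (hbar : ℝ) (b : (Fin n → ℕ) → ℂ) : Prop :=
  Summable fun N => (‖b N‖ / kap hbar N) ^ 2

theorem SqSummable.memℓp (hh : 0 < hbar) {b : (Fin n → ℕ) → ℂ} (hb : SqSummable hbar b) :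
    Memℓp (fun N => b N / kap hbar N) 2 := by
  rw [memℓp_gen_iff (by simp)]
  refine hb.congr fun N => ?_
  simp [abs_of_pos (kap_pos hh N)]

/-- The element of the Bargmann-Fock space with given Taylor coefficients. -/
def ofCoeff [hh : Fact (0 < hbar)] (b : (Fin n → ℕ) → ℂ) (hb : SqSummable hbar b) : HBF n hbar :=
  synth n hbar ⟨fun N => b N / kap hbar N, hb.memℓp hh.out⟩

theorem ofCoeff_fn [hh : Fact (0 < hbar)] (b : (Fin n → ℕ) → ℂ) (hb : SqSummable hbar b) :
    (ofCoeff b hb).fn = antiSeries b := by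
  unfold ofCoeff
  rw [synth_fn]
  congr 1
  funext N
  exact mul_div_cancel₀ _ (Complex.ofReal_ne_zero.2 (kap_pos hh.out N).ne')

theorem norm_ofCoeff_sq [hh : Fact (0 < hbar)] (b : (Fin n → ℕ) → ℂ) (hb : SqSummable hbar b) :
    ‖ofCoeff b hb‖ ^ 2 = ∑' N, (‖b N‖ / kap hbar N) ^ 2 := by
  unfold ofCoeff
  rw [norm_synth, Coeff.norm_sq]
  refine tsum_congr fun N => ?_
  simp [abs_of_pos (kap_pos hh.out N)]

theorem sqSummable_coherent (hh : 0 < hbar) (y : Fin n → ℂ) :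
    SqSummable hbar fun N => ∏ i, y i ^ N i := by
  refine (summable_pow_deg_div_mfact (n := n) (‖y‖ ^ 2 * (2 * hbar))).of_nonneg_of_le
    (fun N => sq_nonneg _) fun N => ?_
  have h3 : (2 * hbar) ^ deg N ≠ 0 := pow_ne_zero _ (mul_pos two_pos hh).ne'
  have h4 : (mfact N : ℝ) ≠ 0 := Nat.cast_ne_zero.2 (mfact_pos N).ne'
  have h5 : (mfact N : ℝ)⁻¹ * (‖y‖ ^ 2 * (2 * hbar)) ^ deg N
      = (‖y‖ ^ deg N) ^ 2 / (mfact N / (2 * hbar) ^ deg N) := by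
    rw [mul_pow, ← pow_mul, ← pow_mul, mul_comm 2 (deg N)]
    field_simp
  rw [div_pow, kap_sq hh, h5]
  have := norm_prod_pow_le y N
  gcongr

theorem antiSeries_exp (y z : Fin n → ℂ) :
    antiSeries (fun N => ∏ i, y i ^ N i) z = Complex.exp (∑ i, y i * conj (z i)) := by
  rw [← (hasSum_exp_multi fun i => y i * conj (z i)).tsum_eq]
  unfold antiSeries expSeries
  refine tsum_congr fun N => ?_
  rw [mul_assoc, ← Finset.prod_mul_distrib]
  simp only [mul_pow]

theorem mono_zero_fn (hbar : ℝ) [Fact (0 < hbar)] (z : Fin n → ℂ) :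
    (mono (n := n) hbar 0).fn z = 1 := by
  change monoFn hbar 0 z = 1
  simp [monoFn, kap, mfact_zero, deg]

theorem U_fn [Fact (0 < hbar)] (g : Heis n) (ψ : HBF n hbar) :
    (U n hbar g ψ).fn = actFun hbar g ψ.fn := rfl

/-- The coherent state `U_g 1` is a multiple of `exp(-w z̄ / 2ħ)`, whose Taylor coefficients are the
monomials in `-w / 2ħ` and hence square-summable for the weight. -/
theorem U_mono_zero_mem [hh : Fact (0 < hbar)] (g : Heis n) :
    ∃ x : Coeff n, U n hbar g (mono hbar 0) = synth n hbar x := by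
  obtain ⟨ψ, hψ⟩ : ∃ ψ : HBF n hbar, (ψ.fn = fun z => Complex.exp (∑ i, (-g.w i / (2 * hbar)) *
      conj (z i))) ∧ ∃ x, ψ = synth n hbar x :=
    ⟨_, (ofCoeff_fn _ (sqSummable_coherent hh.out fun i => -g.w i / (2 * hbar))).trans
      (funext fun z => antiSeries_exp _ z), _, rfl⟩
  obtain ⟨hψ1, x, rfl⟩ := hψ
  refine ⟨Complex.exp (-(Complex.I / (2 * hbar)) * g.c
    - (∑ i, conj (g.w i) * g.w i) / (4 * hbar)) • x, ?_⟩
  rw [map_smul]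
  apply HBF.ext'
  funext z
  rw [HBF.fn_smul, hψ1, U_fn, actFun, mono_zero_fn, mul_one, Pi.smul_apply, smul_eq_mul]
  congr 2
  rw [← Finset.sum_neg_distrib, Finset.sum_div]
  exact Finset.sum_congr rfl fun i _ => by ring

/-- Unitarity moves the translation onto `ψ` and carries the reproducing property from the origin to
`z`. -/
theorem inner_U_mono_zero [Fact (0 < hbar)] (z : Fin n → ℂ) (ψ : HBF n hbar) :
    inner ℂ (U n hbar ⟨z, 0⟩⁻¹ (mono hbar 0)) ψ
      = Complex.exp (- (∑ i, conj (z i) * z i) / (4 * hbar)) * ψ z := by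
  have h : U n hbar ⟨z, 0⟩ (U n hbar (⟨z, 0⟩ : Heis n)⁻¹ (mono hbar 0)) = mono hbar 0 := by
    change (U n hbar ⟨z, 0⟩ * U n hbar (⟨z, 0⟩ : Heis n)⁻¹) (mono hbar 0) = mono hbar 0
    rw [← map_mul, mul_inv_cancel, map_one]
    rfl
  rw [← (U n hbar ⟨z, 0⟩).inner_map_map, h, inner_mono_zero, U_fn]
  simp [actFun, neg_div]

/-- A vector orthogonal to the range is orthogonal to every coherent state, so it vanishes at every
point. -/
theorem range_synth_orthogonal (n : ℕ) (hbar : ℝ) [Fact (0 < hbar)] :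
    (LinearMap.range (synthIso n hbar).toLinearMap)ᗮ = ⊥ := by
  rw [Submodule.eq_bot_iff]
  intro ψ hψ
  rw [Submodule.mem_orthogonal] at hψ
  apply HBF.ext'
  funext z
  obtain ⟨x, hx⟩ := U_mono_zero_mem (hbar := hbar) (⟨z, 0⟩⁻¹ : Heis n)
  have h1 := hψ (synth n hbar x) ⟨x, rfl⟩
  rw [← hx, inner_U_mono_zero] at h1
  exact (mul_eq_zero.1 h1).resolve_left (Complex.exp_ne_zero _)

theorem isComplete_range_synth (n : ℕ) (hbar : ℝ) [Fact (0 < hbar)] :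
    IsComplete (LinearMap.range (synthIso n hbar).toLinearMap : Set (HBF n hbar)) := by
  have h := (LinearIsometry.isComplete_image_iff (synthIso n hbar) (s := Set.univ)).2
    (completeSpace_iff_isComplete_univ.1 inferInstance)
  rw [Set.image_univ] at h
  exact h

theorem synth_surjective (n : ℕ) (hbar : ℝ) [Fact (0 < hbar)] :
    Function.Surjective (synth n hbar) := by
  have : CompleteSpace (LinearMap.range (synthIso n hbar).toLinearMap) :=
    (isComplete_range_synth n hbar).completeSpace_coe
  have h := Submodule.orthogonal_eq_bot_iff.1 (range_synth_orthogonal n hbar)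
  intro ψ
  have h2 : ψ ∈ LinearMap.range (synthIso n hbar).toLinearMap := h ▸ Submodule.mem_top
  exact h2

/-- Completeness later gives the norm-dominated exponential series a sum. -/
instance HBF.completeSpace (n : ℕ) (hbar : ℝ) [Fact (0 < hbar)] : CompleteSpace (HBF n hbar) := by
  rw [completeSpace_iff_isComplete_univ]
  have h := isComplete_range_synth n hbar
  have h2 : (LinearMap.range (synthIso n hbar).toLinearMap : Set (HBF n hbar)) = Set.univ :=
    Set.eq_univ_of_forall fun ψ => synth_surjective n hbar ψ
  rwa [h2] at h

/-- Evaluation at a point is a bounded functional. -/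
theorem HBF.norm_apply_le [Fact (0 < hbar)] (z : Fin n → ℂ) :
    ∃ C : ℝ, ∀ ψ : HBF n hbar, ‖ψ z‖ ≤ C * ‖ψ‖ := by
  refine ⟨‖Complex.exp (-(∑ i, conj (z i) * z i) / (4 * hbar))‖⁻¹, fun ψ => ?_⟩
  have h := norm_inner_le_norm (𝕜 := ℂ) (U n hbar ⟨z, 0⟩⁻¹ (mono hbar 0)) ψ
  rw [inner_U_mono_zero, LinearIsometryEquiv.norm_map, (orthonormal_mono n hbar).1, one_mul,
    norm_mul] at h
  rw [inv_mul_eq_div, le_div_iff₀ (norm_pos_iff.2 (Complex.exp_ne_zero _)), mul_comm]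
  exact h

/-- Finite combinations of monomials are dense. -/
theorem dense_of_finset_sum_mono_mem [Fact (0 < hbar)] {S : Set (HBF n hbar)}
    (hS : ∀ (s : Finset (Fin n → ℕ)) (x : (Fin n → ℕ) → ℂ), ∑ N ∈ s, x N • mono hbar N ∈ S) :
    Dense S := by
  intro ψ
  obtain ⟨x, rfl⟩ := synth_surjective n hbar ψ
  exact mem_closure_of_tendsto (hasSum_synth x) (Filter.Eventually.of_forall fun s => hS s x)

end HilbertSpace

/-! ### Decay of the coefficients of elements of 𝔇, and density -/

section Seminorms

variable {n : ℕ} {hbar : ℝ}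

/-- Super-exponential decay of the normalized Taylor coefficients. -/
def Rapid (b : (Fin n → ℕ) → ℂ) : Prop :=
  ∀ K : ℝ, 0 < K → ∃ C : ℝ, ∀ N, ‖b N‖ ^ 2 * K ^ deg N ≤ C * mfact N

theorem pow_deg_le_exp_mul_mfact {X : ℝ} (hX : 0 ≤ X) (N : Fin n → ℕ) :
    X ^ deg N ≤ Real.exp X ^ n * mfact N := by
  have h : ∀ i, X ^ N i ≤ Real.exp X * (N i).factorial := by
    intro i
    have := Real.pow_div_factorial_le_exp X hX (N i)
    rwa [div_le_iff₀ (by positivity)] at this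
  rw [← prod_pow_eq_pow_deg]
  refine (Finset.prod_le_prod (fun i _ => pow_nonneg hX _) fun i _ => h i).trans (le_of_eq ?_)
  rw [Finset.prod_mul_distrib, Finset.prod_const, Finset.card_univ, Fintype.card_fin, mfact,
    Nat.cast_prod]

/-- The hypothesis bounds `‖b N‖²` by a geometric factor times `√N!`. Multiplying it by `X^|N| ≤
e^{nX} N!` with `X = (K / 2ħ)²` and taking square roots gives the claim for `K`. -/
theorem rapid_of_fourth_power_le (hh : 0 < hbar) {b : (Fin n → ℕ) → ℂ} {H : ℝ}
    (hb : ∀ N, ((2 * hbar) ^ deg N * ‖b N‖ ^ 2) ^ 2 ≤ H * mfact N) : Rapid b := by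
  intro K hK
  have hH : 0 ≤ H := by
    have := (sq_nonneg _).trans (hb 0)
    simpa [mfact_zero] using this
  set X : ℝ := (K / (2 * hbar)) ^ 2 with hX
  refine ⟨√(H * Real.exp X ^ n), fun N => ?_⟩
  have h2 : (0 : ℝ) < (2 * hbar) ^ deg N := by positivity
  have h1 : (‖b N‖ ^ 2 * K ^ deg N) ^ 2 ≤ (√(H * Real.exp X ^ n) * mfact N) ^ 2 := by
    rw [mul_pow (√_), Real.sq_sqrt (by positivity)]
    calc (‖b N‖ ^ 2 * K ^ deg N) ^ 2
        = ((2 * hbar) ^ deg N * ‖b N‖ ^ 2) ^ 2 * X ^ deg N := by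
          have hXe : X ^ deg N = (K ^ deg N) ^ 2 / ((2 * hbar) ^ deg N) ^ 2 := by
            rw [hX, pow_right_comm, div_pow, div_pow]
          rw [hXe]
          generalize (2 * hbar) ^ deg N = y at h2
          field_simp
      _ ≤ (H * mfact N) * (Real.exp X ^ n * mfact N) := by
          have := pow_deg_le_exp_mul_mfact (sq_nonneg (K / (2 * hbar))) N
          gcongr
          exact hb N
      _ = _ := by ring
  exact le_of_sq_le_sq h1 (by positivity)

theorem Rapid.sqSummable (hh : 0 < hbar) {b : (Fin n → ℕ) → ℂ} (hb : Rapid b) :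
    SqSummable hbar b := by
  -- The weight in the norm is `(2ħ)^|N| / N!`; twice its base leaves a convergent factor
  -- `2^{-|N|}`.
  obtain ⟨C, hC⟩ := hb (4 * hbar) (by positivity)
  refine ((summable_geometric_deg (n := n) (r := 1 / 2) (by norm_num) (by norm_num)).mul_left
    C).of_nonneg_of_le (fun N => sq_nonneg _) fun N => ?_
  have h3 : (0 : ℝ) < (2 * hbar) ^ deg N := by positivity
  have h4 : (0 : ℝ) < mfact N := Nat.cast_pos.2 (mfact_pos N)
  rw [div_pow, kap_sq hh, div_div_eq_mul_div, div_le_iff₀ h4]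
  have h5 := hC N
  rw [show 4 * hbar = 2 * (2 * hbar) by ring, mul_pow] at h5
  rw [one_div, inv_pow, mul_right_comm, ← div_eq_mul_inv, le_div_iff₀ (by positivity)]
  linarith

theorem Rapid.entire {b : (Fin n → ℕ) → ℂ} (hb : Rapid b) : Entire b := by
  -- Neither `Rapid` nor `Entire` involves ħ, so the weight may be taken at ħ = 1.
  have h : Summable fun N => ‖b N / kap 1 N‖ ^ 2 := by
    refine (hb.sqSummable one_pos).congr fun N => ?_
    rw [norm_div, Complex.norm_real, Real.norm_of_nonneg (kap_pos one_pos N).le]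
  have h2 := entire_kap_mul one_pos h
  have e : (fun N => (kap 1 N : ℂ) * (b N / kap 1 N)) = b := funext fun N =>
    mul_div_cancel₀ _ (Complex.ofReal_ne_zero.2 (kap_pos one_pos N).ne')
  rwa [e] at h2

theorem hSem_lt_top {p : Fin n → ℂ} {f : (Fin n → ℂ) → ℂ} (hf : f ∈ Aph n hbar p) {m l : ℕ}
    (hl : l < 2 ^ m) (R S : Fin n → ℕ) : hSem hbar p f m l R S < ∞ := by
  by_contra h
  have h1 := hf.2 m l hl R S
  rw [semi, not_lt_top_iff.1 h, ENNReal.top_rpow_of_pos (by positivity)] at h1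
  exact lt_irrefl _ h1

theorem mchoose_self (M : Fin n → ℕ) : mchoose M M = 1 := by simp [mchoose]

theorem hSem_zero_ge (f : (Fin n → ℂ) → ℂ) (M : Fin n → ℕ) :
    ENNReal.ofReal ((2 * hbar) ^ deg M * ‖dzbarPow M f 0‖ ^ 2) ≤ hSem hbar 0 f 0 0 0 M := by
  rw [hSem]
  refine le_trans (le_of_eq ?_) (ENNReal.le_tsum 0)
  rw [zero_add, mfact_zero]
  have h0 : deg (0 : Fin n → ℕ) = 0 := deg_eq_zero.2 rfl
  have h1 : dzPow 0 (dzbarPow M f) = dzbarPow M f := by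
    unfold dzPow
    simp
  rw [h0, h1]
  simp

/-- Only the summand `N = M`, `I = 0`, `J = M` is kept. Its square against a single `M!` is the
source of the fourth-power bound on the coefficients. -/
theorem hSem_one_ge (p : Fin n → ℂ) (f : (Fin n → ℂ) → ℂ) (M : Fin n → ℕ) :
    (mfact M : ℝ≥0∞)⁻¹ * hSem hbar p f 0 0 0 M ^ 2 ≤ hSem hbar p f 1 0 0 0 := by
  conv_rhs => rw [hSem, if_pos (by decide)]
  refine le_trans ?_ (ENNReal.le_tsum M)
  gcongr
  rw [Finset.Icc_self, Finset.sum_singleton]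
  refine le_trans (le_of_eq ?_) (Finset.single_le_sum (fun _ _ => zero_le)
    (Finset.mem_Icc.2 ⟨zero_le, (add_zero M).ge⟩))
  rw [add_zero, mchoose_self, mchoose_self]
  simp

/-- Of all the seminorms, finiteness of the one with `m = 1` and `ℓ = 0`, `R = S = 0` suffices. -/
theorem rapid_of_mem_Aph (hh : 0 < hbar) {f : (Fin n → ℂ) → ℂ} (hf : f ∈ Aph n hbar 0) :
    Rapid fun N => dzbarPow N f 0 := by
  have hH := hSem_lt_top hf (m := 1) (l := 0) (by norm_num) 0 0
  refine rapid_of_fourth_power_le hh (H := (hSem hbar 0 f 1 0 0 0).toReal) fun M => ?_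
  have h1 := hSem_one_ge (hbar := hbar) 0 f M
  have h2 := hSem_zero_ge (hbar := hbar) f M
  have hM0 : (mfact M : ℝ≥0∞) ≠ 0 := Nat.cast_ne_zero.2 (mfact_pos M).ne'
  rw [← ENNReal.div_eq_inv_mul, ENNReal.div_le_iff hM0 (ENNReal.natCast_ne_top _)] at h1
  have h3 := (pow_le_pow_left₀ zero_le h2 2).trans h1
  rw [← ENNReal.ofReal_pow (by positivity)] at h3
  have h4 := ENNReal.toReal_mono (ENNReal.mul_ne_top hH.ne (ENNReal.natCast_ne_top _)) h3
  rwa [ENNReal.toReal_ofReal (by positivity), ENNReal.toReal_mul, ENNReal.toReal_natCast] at h4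

theorem exists_rapid_of_mem_D (hh : 0 < hbar) {φ : (Fin n → ℂ) → ℂ} (hφ : φ ∈ D n hbar) :
    ∃ b, Rapid b ∧ φ = antiSeries b := by
  obtain ⟨f, hf, rfl⟩ := hφ
  exact ⟨_, rapid_of_mem_Aph hh hf, rfl⟩

theorem D_subset_bfSpace (n : ℕ) (hbar : ℝ) [hh : Fact (0 < hbar)] :
    ∀ φ ∈ D n hbar, φ ∈ bfSpace n hbar := by
  intro φ hφ
  obtain ⟨b, hb, rfl⟩ := exists_rapid_of_mem_D hh.out hφ
  rw [← ofCoeff_fn b (hb.sqSummable hh.out)]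
  exact HBF.mem _

/-! ### Anti-holomorphic polynomials belong to `𝒜_ħ` -/

theorem ENNReal_tsum_pow_deg_div_mfact_lt_top (K : ℝ) :
    ∑' N : Fin n → ℕ, ENNReal.ofReal ((mfact N : ℝ)⁻¹ * K ^ deg N) < ∞ :=
  (summable_pow_deg_div_mfact K).tsum_ofReal_lt_top

theorem sum_mchoose_mul_pow (K : ℝ≥0∞) (R : Fin n → ℕ) :
    ∑ I ∈ Finset.Icc 0 R, (mchoose R I : ℝ≥0∞) * K ^ deg I = (1 + K) ^ deg R := by
  have e : Finset.Icc 0 R = Fintype.piFinset fun i => Finset.range (R i + 1) := by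
    ext I
    simp [Finset.mem_Icc, Pi.le_def]
  have h := Finset.prod_univ_sum (fun i => Finset.range (R i + 1))
    (fun i k => ((R i).choose k : ℝ≥0∞) * K ^ k)
  rw [e, ← prod_pow_eq_pow_deg]
  simp only [add_comm 1 K, add_pow, one_pow, mul_one]
  simp only [mul_comm (K ^ _)]
  rw [h]
  refine Finset.sum_congr rfl fun I _ => ?_
  rw [Finset.prod_mul_distrib, prod_pow_eq_pow_deg, mchoose, Nat.cast_prod]

theorem sum_sum_mchoose_le {h : (Fin n → ℕ) → (Fin n → ℕ) → ℝ≥0∞} {C K : ℝ≥0∞}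
    (hle : ∀ I J, h I J ≤ C * K ^ (deg I + deg J)) (R T : Fin n → ℕ) :
    ∑ I ∈ Finset.Icc 0 R, ∑ J ∈ Finset.Icc 0 T,
      (mchoose R I : ℝ≥0∞) * (mchoose T J : ℝ≥0∞) * h I J ≤ C * (1 + K) ^ (deg R + deg T) := by
  rw [pow_add, ← sum_mchoose_mul_pow, ← sum_mchoose_mul_pow, Finset.sum_mul_sum, Finset.mul_sum]
  refine Finset.sum_le_sum fun I _ => ?_
  rw [Finset.mul_sum]
  refine Finset.sum_le_sum fun J _ => ?_
  refine (mul_le_mul_right (hle I J) _).trans (le_of_eq ?_)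
  rw [pow_add]
  ring

/-- One step of the recursion preserves bounds exponential in `|R| + |S|`: the binomial theorem
turns `K` into `1 + K`, squaring gives `L = (1 + K)²`, and `1/N!` absorbs `L^|N|`. -/
theorem tsum_sq_sum_mchoose_le {h : (Fin n → ℕ) → (Fin n → ℕ) → ℝ≥0∞} {C K : ℝ≥0∞}
    (hC : C < ∞) (hK : K < ∞) (hle : ∀ I J, h I J ≤ C * K ^ (deg I + deg J)) :
    ∃ C' K' : ℝ≥0∞, C' < ∞ ∧ K' < ∞ ∧ ∀ R S : Fin n → ℕ,
      ∑' N : Fin n → ℕ, (mfact N : ℝ≥0∞)⁻¹ * (∑ I ∈ Finset.Icc 0 R, ∑ J ∈ Finset.Icc 0 (N + S),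
        (mchoose R I : ℝ≥0∞) * (mchoose (N + S) J : ℝ≥0∞) * h I J) ^ 2
        ≤ C' * K' ^ (deg R + deg S) := by
  set L : ℝ≥0∞ := (1 + K) ^ 2 with hL
  have hLt : L < ∞ := ENNReal.pow_lt_top (ENNReal.add_lt_top.2 ⟨ENNReal.one_lt_top, hK⟩)
  refine ⟨C ^ 2 * ∑' N : Fin n → ℕ, (mfact N : ℝ≥0∞)⁻¹ * L ^ deg N, L, ?_, hLt, fun R S => ?_⟩
  · refine ENNReal.mul_lt_top (ENNReal.pow_lt_top hC) ?_
    refine lt_of_eq_of_lt (tsum_congr fun N => ?_)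
      (ENNReal_tsum_pow_deg_div_mfact_lt_top (n := n) L.toReal)
    rw [ENNReal.ofReal_mul (by positivity), ENNReal.ofReal_pow ENNReal.toReal_nonneg,
      ENNReal.ofReal_toReal hLt.ne, ENNReal.ofReal_inv_of_pos (Nat.cast_pos.2 (mfact_pos N)),
      ENNReal.ofReal_natCast]
  · rw [mul_right_comm, ← ENNReal.tsum_mul_left]
    refine ENNReal.tsum_le_tsum fun N => ?_
    calc _ ≤ (mfact N : ℝ≥0∞)⁻¹ * (C * (1 + K) ^ (deg R + deg (N + S))) ^ 2 := by
          gcongr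
          exact sum_sum_mchoose_le hle R (N + S)
      _ = _ := by
          rw [hL, deg_add]
          simp only [← pow_mul, pow_add, mul_pow]
          ring

theorem hSem_le_of_hSem_zero_le {p : Fin n → ℂ} {f : (Fin n → ℂ) → ℂ} {C K : ℝ≥0∞} (hC : C < ∞)
    (hK : K < ∞) (hle : ∀ l R S, hSem hbar p f 0 l R S ≤ C * K ^ (deg R + deg S)) :
    ∀ m l, ∃ C' K' : ℝ≥0∞, C' < ∞ ∧ K' < ∞ ∧
      ∀ R S, hSem hbar p f m l R S ≤ C' * K' ^ (deg R + deg S) := by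
  intro m
  induction m with
  | zero => exact fun l => ⟨C, K, hC, hK, hle l⟩
  | succ m ih =>
    intro l
    by_cases hl : Even l
    · obtain ⟨C', K', hC', hK', h⟩ := ih (l / 2)
      obtain ⟨C'', K'', hC'', hK'', h'⟩ := tsum_sq_sum_mchoose_le hC' hK' h
      refine ⟨C'', K'', hC'', hK'', fun R S => ?_⟩
      rw [hSem, if_pos hl]
      exact h' R S
    · obtain ⟨C', K', hC', hK', h⟩ := ih ((l - 1) / 2)
      -- The bound is symmetric in the two multiindices, so the exchange of `I` and `J` at odd `l`
      -- is harmless.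
      obtain ⟨C'', K'', hC'', hK'', h'⟩ := tsum_sq_sum_mchoose_le
        (h := fun I J => hSem hbar p f m ((l - 1) / 2) J I) hC' hK' fun I J => by
          rw [add_comm]
          exact h J I
      refine ⟨C'', K'', hC'', hK'', fun R S => ?_⟩
      rw [hSem, if_neg hl]
      exact h' R S

/-- With all derivatives at `p` bounded by `C`, the level-zero quantities are at most a constant
times `(2ħ)^(|R| + |S|)`, and the recursion keeps a bound of this type. -/
theorem mem_Aph_of_bound (hh : 0 < hbar) {f : (Fin n → ℂ) → ℂ} (hf : AnalyticOnNhd ℝ f Set.univ)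
    {p : Fin n → ℂ} {C : ℝ} (hC : ∀ R S, ‖dzPow R (dzbarPow S f) p‖ ≤ C) : f ∈ Aph n hbar p := by
  refine ⟨hf, fun m l _ R S => ?_⟩
  have hs := ENNReal_tsum_pow_deg_div_mfact_lt_top (n := n) (2 * hbar)
  obtain ⟨C', K', hC', hK', h⟩ := hSem_le_of_hSem_zero_le (hbar := hbar) (p := p) (f := f)
    (C := ENNReal.ofReal (C ^ 2) * ∑' N : Fin n → ℕ,
      ENNReal.ofReal ((mfact N : ℝ)⁻¹ * (2 * hbar) ^ deg N)) (K := ENNReal.ofReal (2 * hbar))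
    (ENNReal.mul_lt_top ENNReal.ofReal_lt_top hs) ENNReal.ofReal_lt_top (fun l R S => by
      rw [hSem, mul_right_comm, ← ENNReal.tsum_mul_left]
      refine ENNReal.tsum_le_tsum fun N => ?_
      rw [← ENNReal.ofReal_pow (by positivity), ← ENNReal.ofReal_mul (by positivity),
        ← ENNReal.ofReal_mul (by positivity)]
      refine ENNReal.ofReal_le_ofReal ?_
      rw [pow_add, div_mul_eq_mul_div, div_eq_inv_mul]
      have := hC R (N + S)
      have h0 : ‖dzPow R (dzbarPow (N + S) f) p‖ ^ 2 ≤ C ^ 2 :=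
        pow_le_pow_left₀ (norm_nonneg _) this 2
      calc _ ≤ (mfact N : ℝ)⁻¹ * ((2 * hbar) ^ (deg R + deg S) * (2 * hbar) ^ deg N * C ^ 2) := by
            gcongr
        _ = _ := by ring) m l
  exact ENNReal.rpow_lt_top_of_nonneg (by positivity)
    ((h R S).trans_lt (ENNReal.mul_lt_top hC' (ENNReal.pow_lt_top hK'))).ne

theorem entire_of_finite_support {b : (Fin n → ℕ) → ℂ} {s : Finset (Fin n → ℕ)}
    (hb : ∀ N ∉ s, b N = 0) : Entire b := fun r _ =>
  summable_of_ne_finset_zero (s := s) fun N hN => by simp [hb N hN]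

theorem antiSeries_analytic_of_finite_support {b : (Fin n → ℕ) → ℂ} {s : Finset (Fin n → ℕ)}
    (hb : ∀ N ∉ s, b N = 0) : AnalyticOnNhd ℝ (antiSeries b) Set.univ := by
  have e : antiSeries b = fun z => ∑ N ∈ s, (mfact N : ℂ)⁻¹ * b N * ∏ i, conj (z i) ^ N i := by
    funext z
    exact tsum_eq_sum fun N hN => by simp [hb N hN]
  rw [e]
  intro z _
  have hcoord : ∀ i : Fin n, AnalyticAt ℝ (fun z : Fin n → ℂ => conj (z i)) z := fun i =>
    ((Complex.conjCLE : ℂ →L[ℝ] ℂ).comp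
      (ContinuousLinearMap.proj (R := ℝ) (φ := fun _ : Fin n => ℂ) i)).analyticAt z
  refine Finset.analyticAt_fun_sum _ fun N _ => analyticAt_const.mul ?_
  exact Finset.analyticAt_fun_prod _ fun i _ => (hcoord i).pow _

/-- An anti-holomorphic polynomial has finitely many nonzero derivatives at the origin and is its
own image under `Psi`. -/
theorem antiSeries_mem_D_of_finite_support (hh : 0 < hbar) {b : (Fin n → ℕ) → ℂ}
    {s : Finset (Fin n → ℕ)} (hb : ∀ N ∉ s, b N = 0) : antiSeries b ∈ D n hbar := by
  have hE := entire_of_finite_support hb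
  have hbound : ∀ N, ‖b N‖ ≤ ∑ M ∈ s, ‖b M‖ := by
    intro N
    by_cases hN : N ∈ s
    · exact Finset.single_le_sum (f := fun M => ‖b M‖) (fun _ _ => norm_nonneg _) hN
    · rw [hb N hN, norm_zero]
      exact Finset.sum_nonneg fun _ _ => norm_nonneg _
  refine ⟨antiSeries b, mem_Aph_of_bound hh (antiSeries_analytic_of_finite_support hb)
    (C := ∑ M ∈ s, ‖b M‖) fun R S => ?_, ?_⟩
  · rw [hE.dzbarPow_antiSeries]
    by_cases hR : R = 0
    · have h1 : dzPow 0 (antiSeries (shift S b)) = antiSeries (shift S b) := by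
        unfold dzPow
        simp
      rw [hR, h1, antiSeries_zero]
      exact hbound _
    · rw [(hE.shift S).dzPow_antiSeries hR]
      simpa using Finset.sum_nonneg fun M _ => norm_nonneg (b M)
  · rw [Psi_eq_antiSeries]
    congr 1
    funext N
    rw [hE.dzbarPow_antiSeries, antiSeries_zero, shift, zero_add]

theorem dense_D (n : ℕ) (hbar : ℝ) [hh : Fact (0 < hbar)] :
    Dense {ψ : HBF n hbar | ψ.fn ∈ D n hbar} := by
  classical
  refine dense_of_finset_sum_mono_mem fun s x => ?_
  have e : (∑ N ∈ s, x N • mono hbar N).fn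
      = antiSeries fun N => if N ∈ s then kap hbar N * x N else 0 := by
    funext z
    rw [HBF.fn_sum, Finset.sum_apply]
    unfold antiSeries expSeries
    rw [tsum_eq_sum (s := s) fun N hN => by simp [hN]]
    refine Finset.sum_congr rfl fun N hN => ?_
    change x N * monoFn hbar N z = (mfact N : ℂ)⁻¹ * (if N ∈ s then kap hbar N * x N else 0) *
      ∏ i, conj (z i) ^ N i
    rw [if_pos hN]
    unfold monoFn
    push_cast
    ring
  change (∑ N ∈ s, x N • mono hbar N).fn ∈ D n hbar
  rw [e]
  exact antiSeries_mem_D_of_finite_support hh.out (s := s) fun N hN => if_neg hN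

end Seminorms

/-! ### Growth of coefficients under creation and annihilation operators -/

section Ladder

variable {n : ℕ} {hbar : ℝ}

/-- The Taylor coefficients of `∂ψ/∂z̄ⁱ`, as a linear map. -/
def lower (i : Fin n) : Module.End ℂ ((Fin n → ℕ) → ℂ) where
  toFun := shift (Pi.single i 1)
  map_add' _ _ := rfl
  map_smul' _ _ := rfl

/-- The Taylor coefficients of `z̄ⁱ ψ`, as a linear map. -/
def raise (i : Fin n) : Module.End ℂ ((Fin n → ℕ) → ℂ) where
  toFun b := fun N => N i * b (N - Pi.single i 1)
  map_add' a b := by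
    funext N
    simp only [Pi.add_apply, mul_add]
  map_smul' c b := by
    funext N
    simp only [Pi.smul_apply, smul_eq_mul, RingHom.id_apply]
    ring

/-- The ladder operators, indexed by two copies of `Fin n`. -/
def ladder : Fin n ⊕ Fin n → Module.End ℂ ((Fin n → ℕ) → ℂ) := Sum.elim lower raise

theorem raise_add_single (i : Fin n) (b : (Fin n → ℕ) → ℂ) (N : Fin n → ℕ) :
    raise i b (N + Pi.single i 1) = (N i + 1) * b N := by
  simp [raise]

theorem raise_eq_zero (i : Fin n) (b : (Fin n → ℕ) → ℂ) {N : Fin n → ℕ} (h : N i = 0) :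
    raise i b N = 0 := by
  simp [raise, h]

theorem exists_eq_add_single {i : Fin n} {N : Fin n → ℕ} (h : N i ≠ 0) :
    ∃ M : Fin n → ℕ, N = M + Pi.single i 1 := by
  refine ⟨N - Pi.single i 1, (tsub_add_cancel_of_le fun j => ?_).symm⟩
  by_cases hj : j = i
  · subst hj
    simpa [Nat.one_le_iff_ne_zero] using h
  · simp [Pi.single_eq_of_ne hj]

theorem apply_le_deg (N : Fin n → ℕ) (i : Fin n) : N i ≤ deg N :=
  Finset.single_le_sum (f := N) (fun _ _ => Nat.zero_le _) (Finset.mem_univ i)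

/-- The growth of Taylor coefficients after the application of `r` ladder operators. -/
def Growth (C K : ℝ) (r : ℕ) (b : (Fin n → ℕ) → ℂ) : Prop :=
  ∀ N, ‖b N‖ ^ 2 * K ^ deg N ≤ C * K ^ r * mfact N * (deg N + 1).ascFactorial r

/-- Passing to `N + e_i` multiplies `N!` by `N i + 1 ≤ |N| + 1`, exactly the factor that extends
`(|N| + 2) ⋯ (|N| + r + 1)` downwards to `r + 1` factors. The changes in the powers of `K` are
covered by `K ≥ 1`. -/
theorem Growth.lower {C K : ℝ} (hC : 0 ≤ C) (hK : 1 ≤ K) {r : ℕ} {b : (Fin n → ℕ) → ℂ}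
    (hb : Growth C K r b) (i : Fin n) : Growth C K (r + 1) (lower i b) := by
  intro N
  have h := hb (N + Pi.single i 1)
  have hK0 : 0 ≤ K := zero_le_one.trans hK
  have hasc : (deg N + 1) * (deg N + 2).ascFactorial r = (deg N + 1).ascFactorial (r + 1) := by
    rw [Nat.ascFactorial_succ]
    exact Nat.succ_ascFactorial _ _
  have hi : (N i : ℝ) + 1 ≤ deg N + 1 := by
    have := apply_le_deg N i
    gcongr
  rw [deg_add, deg_single, mfact_add_single] at h
  calc ‖b (N + Pi.single i 1)‖ ^ 2 * K ^ deg N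
      ≤ ‖b (N + Pi.single i 1)‖ ^ 2 * K ^ (deg N + 1) := by
        gcongr
        exact Nat.le_succ _
    _ ≤ C * K ^ r * ((N i + 1) * mfact N) * (deg N + 2).ascFactorial r := by
        refine h.trans (le_of_eq ?_)
        push_cast
        rfl
    _ ≤ C * K ^ (r + 1) * ((deg N + 1) * mfact N) * (deg N + 2).ascFactorial r := by
        gcongr
        exact Nat.le_succ _
    _ = C * K ^ (r + 1) * mfact N * (deg N + 1).ascFactorial (r + 1) := by
        rw [← hasc]
        push_cast
        ring

/-- With `N = M + e_i`, the squared norm gains `(M i + 1)²`: one factor belongs to `N!`, the other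
is at most `|M| + 1` and is absorbed by the longer ascending factorial. The extra power of `K`
accounts for `|N| = |M| + 1`. -/
theorem Growth.raise {C K : ℝ} (hC : 0 ≤ C) (hK : 1 ≤ K) {r : ℕ} {b : (Fin n → ℕ) → ℂ}
    (hb : Growth C K r b) (i : Fin n) : Growth C K (r + 1) (raise i b) := by
  intro N
  have hK0 : 0 ≤ K := zero_le_one.trans hK
  by_cases hN : N i = 0
  · rw [raise_eq_zero i b hN]
    rw [norm_zero, zero_pow two_ne_zero, zero_mul]
    positivity
  obtain ⟨M, rfl⟩ := exists_eq_add_single hN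
  have h := hb M
  have hi : (M i : ℝ) + 1 ≤ deg M + 1 := by
    have := apply_le_deg M i
    gcongr
  have hasc : (deg M + 1) * (deg M + 1).ascFactorial r ≤ (deg M + 2).ascFactorial (r + 1) := by
    rw [Nat.ascFactorial_succ]
    have h1 : (deg M + 1) * (deg M + 2).ascFactorial r
        = (deg M + 1 + r) * (deg M + 1).ascFactorial r := Nat.succ_ascFactorial _ _
    calc (deg M + 1) * (deg M + 1).ascFactorial r
        ≤ (deg M + 1 + r) * (deg M + 1).ascFactorial r := Nat.mul_le_mul_right _ (by omega)
      _ = (deg M + 1) * (deg M + 2).ascFactorial r := h1.symm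
      _ ≤ _ := Nat.mul_le_mul_right _ (by omega)
  have hasc' : ((deg M : ℝ) + 1) * (deg M + 1).ascFactorial r ≤ (deg M + 2).ascFactorial (r + 1) := by
    exact_mod_cast hasc
  have hn : ‖WickBF.raise i b (M + Pi.single i 1)‖ = (M i + 1) * ‖b M‖ := by
    rw [raise_add_single, norm_mul]
    congr 1
    exact_mod_cast Complex.norm_natCast (M i + 1)
  rw [hn, deg_add, deg_single, mfact_add_single]
  calc ((M i + 1) * ‖b M‖) ^ 2 * K ^ (deg M + 1)
      = ((M i + 1) ^ 2 * K) * (‖b M‖ ^ 2 * K ^ deg M) := by ring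
    _ ≤ ((M i + 1) ^ 2 * K) * (C * K ^ r * mfact M * (deg M + 1).ascFactorial r) := by gcongr
    _ = C * K ^ (r + 1) * ((M i + 1) * mfact M) * ((M i + 1) * (deg M + 1).ascFactorial r) := by
        ring
    _ ≤ C * K ^ (r + 1) * ((M i + 1) * mfact M) * ((deg M + 1) * (deg M + 1).ascFactorial r) := by
        gcongr
    _ ≤ C * K ^ (r + 1) * ((M i + 1) * mfact M) * (deg M + 2).ascFactorial (r + 1) := by
        gcongr
    _ = _ := by
        push_cast
        rfl

theorem Growth.ladder {C K : ℝ} (hC : 0 ≤ C) (hK : 1 ≤ K) {r : ℕ} {b : (Fin n → ℕ) → ℂ}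
    (hb : Growth C K r b) (l : Fin n ⊕ Fin n) : Growth C K (r + 1) (ladder l b) := by
  cases l with
  | inl i => exact hb.lower hC hK i
  | inr i => exact hb.raise hC hK i

theorem ascFactorial_le (m r : ℕ) :
    (m + 1).ascFactorial r ≤ r.factorial * (2 ^ m * 2 ^ r) := by
  rw [Nat.ascFactorial_eq_factorial_mul_choose, ← pow_add]
  exact Nat.mul_le_mul_left _ (Nat.choose_le_two_pow _ _)

/-- The ascending factorial is at most `r! 2^|N| 2^r`; halving `K` on the left pays for `2^|N|`, so
only `√r!` growth in `r` remains after taking roots. -/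
theorem Growth.bound {C K : ℝ} (hC : 0 ≤ C) (hK : 0 ≤ K) {r : ℕ} {b : (Fin n → ℕ) → ℂ}
    (hb : Growth C K r b) (N : Fin n → ℕ) :
    ‖b N‖ ^ 2 * (K / 2) ^ deg N ≤ C * (2 * K) ^ r * r.factorial * mfact N := by
  have h1 : ((deg N + 1).ascFactorial r : ℝ) ≤ r.factorial * (2 ^ deg N * 2 ^ r) := by
    exact_mod_cast ascFactorial_le (deg N) r
  rw [div_pow, mul_div_assoc', div_le_iff₀ (by positivity)]
  refine (hb N).trans ?_
  calc C * K ^ r * mfact N * (deg N + 1).ascFactorial r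
      ≤ C * K ^ r * mfact N * (r.factorial * (2 ^ deg N * 2 ^ r)) := by gcongr
    _ = _ := by
        rw [mul_pow]
        ring

theorem Rapid.exists_growth {b : (Fin n → ℕ) → ℂ} (hb : Rapid b) {K : ℝ} (hK : 0 < K) :
    ∃ C, 0 ≤ C ∧ Growth C K 0 b := by
  obtain ⟨C, hC⟩ := hb K hK
  refine ⟨max C 0, le_max_right _ _, fun N => (hC N).trans ?_⟩
  simp only [pow_zero, mul_one, Nat.ascFactorial_zero, Nat.cast_one]
  gcongr
  exact le_max_left _ _

theorem Rapid.ladder {b : (Fin n → ℕ) → ℂ} (hb : Rapid b) (l : Fin n ⊕ Fin n) :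
    Rapid (ladder l b) := by
  intro K hK
  -- The factor two anticipates the halving in `Growth.bound`, and the maximum secures the base at
  -- least one that the ladder estimates require.
  have hK1 : (1 : ℝ) ≤ 2 * max K 1 := by
    have := le_max_right K 1
    linarith
  obtain ⟨C, hC, hg⟩ := hb.exists_growth (zero_lt_one.trans_le hK1)
  refine ⟨C * (2 * (2 * max K 1)) ^ 1 * (Nat.factorial 1), fun N => ?_⟩
  refine le_trans ?_ ((hg.ladder hC hK1 l).bound hC (zero_le_one.trans hK1) N)
  rw [mul_div_cancel_left₀ _ two_ne_zero]
  gcongr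
  exact le_max_left _ _

/-- The rapidly decaying families as a subspace. -/
def rapidSubmodule (n : ℕ) : Submodule ℂ ((Fin n → ℕ) → ℂ) where
  carrier := {b | Rapid b}
  zero_mem' := fun K _ => ⟨0, fun N => by simp⟩
  add_mem' := fun {a b} ha hb K hK => by
    obtain ⟨C, hC⟩ := ha K hK
    obtain ⟨C', hC'⟩ := hb K hK
    refine ⟨2 * (C + C'), fun N => ?_⟩
    have h : ‖(a + b) N‖ ^ 2 ≤ 2 * (‖a N‖ ^ 2 + ‖b N‖ ^ 2) :=
      (pow_le_pow_left₀ (norm_nonneg _) (norm_add_le _ _) 2).trans (add_sq_le)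
    calc ‖(a + b) N‖ ^ 2 * K ^ deg N ≤ 2 * (‖a N‖ ^ 2 + ‖b N‖ ^ 2) * K ^ deg N := by gcongr
      _ ≤ _ := by linarith [hC N, hC' N]
  smul_mem' := fun c b hb K hK => by
    obtain ⟨C, hC⟩ := hb K hK
    refine ⟨‖c‖ ^ 2 * C, fun N => ?_⟩
    rw [Pi.smul_apply, norm_smul, mul_pow, mul_assoc, mul_assoc]
    have := hC N
    gcongr

theorem antiSeries_sum {ι : Type*} (s : Finset ι) (c : ι → ℂ) {b : ι → (Fin n → ℕ) → ℂ}
    (hb : ∀ l ∈ s, Entire (b l)) (z : Fin n → ℂ) :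
    antiSeries (∑ l ∈ s, c l • b l) z = ∑ l ∈ s, c l * antiSeries (b l) z := by
  have h := hasSum_sum fun l hl => ((hb l hl).hasSum fun i => conj (z i)).mul_left (c l)
  refine (h.congr_fun fun N => ?_).tsum_eq
  rw [Finset.sum_apply, Finset.mul_sum, Finset.sum_mul]
  refine Finset.sum_congr rfl fun l _ => ?_
  rw [Pi.smul_apply, smul_eq_mul]
  ring

theorem Entire.antiSeries_lower {b : (Fin n → ℕ) → ℂ} (hb : Entire b) (i : Fin n) :
    antiSeries (lower i b) = dzbar i (antiSeries b) :=
  (hb.dzbar_antiSeries i).symm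

theorem Entire.antiSeries_raise {b : (Fin n → ℕ) → ℂ} (hb : Entire b) (i : Fin n)
    (z : Fin n → ℂ) : antiSeries (raise i b) z = conj (z i) * antiSeries b z := by
  refine HasSum.tsum_eq ?_
  have hinj : Function.Injective fun N : Fin n → ℕ => N + Pi.single i 1 := add_left_injective _
  rw [← hinj.hasSum_iff]
  · refine ((hb.hasSum fun i => conj (z i)).mul_left (conj (z i))).congr_fun fun N => ?_
    have h1 : ((N i : ℂ) + 1) ≠ 0 := by exact_mod_cast Nat.succ_ne_zero (N i)
    have h2 : (mfact N : ℂ) ≠ 0 := Nat.cast_ne_zero.2 (mfact_pos N).ne'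
    rw [Function.comp_apply, raise_add_single, mfact_add_single]
    simp only [Pi.add_apply, pow_add, Finset.prod_mul_distrib, prod_pow_single]
    push_cast
    field_simp
  · intro N hN
    rw [raise_eq_zero, mul_zero, zero_mul]
    by_contra h
    obtain ⟨M, rfl⟩ := exists_eq_add_single h
    exact hN ⟨M, rfl⟩

/-- The coefficient functionals of `∑_i (w̄ⁱ a_i - wⁱ a_i†)` with respect to the ladder
operators. -/
def letter (hbar : ℝ) : Fin n ⊕ Fin n → ((Fin n → ℂ) →L[ℝ] ℂ)
  | Sum.inl i => (2 * hbar) • (Complex.conjCLE : ℂ →L[ℝ] ℂ).comp (ContinuousLinearMap.proj i)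
  | Sum.inr i => -ContinuousLinearMap.proj i

theorem letter_inl (i : Fin n) (w : Fin n → ℂ) :
    letter hbar (Sum.inl i) w = 2 * hbar * conj (w i) := by
  simp [letter]

theorem letter_inr (i : Fin n) (w : Fin n → ℂ) : letter hbar (Sum.inr i) w = -w i := by
  simp [letter]

theorem norm_letter_le (hh : 0 < hbar) (l : Fin n ⊕ Fin n) (w : Fin n → ℂ) :
    ‖letter hbar l w‖ ≤ (2 * hbar + 1) * ‖w‖ := by
  have hw : ∀ i, ‖w i‖ ≤ ‖w‖ := norm_le_pi_norm w
  cases l with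
  | inl i =>
    rw [letter_inl, norm_mul, norm_mul, RCLike.norm_conj, Complex.norm_real,
      Real.norm_of_nonneg hh.le, Complex.norm_ofNat]
    have := hw i
    nlinarith [norm_nonneg (w i), norm_nonneg w]
  | inr i =>
    rw [letter_inr, norm_neg]
    have := hw i
    nlinarith [norm_nonneg w]

/-- The action of `∑_i (w̄ⁱ a_i - wⁱ a_i†)` on Taylor coefficients. -/
def fieldCoeff (hbar : ℝ) (w : Fin n → ℂ) : Module.End ℂ ((Fin n → ℕ) → ℂ) :=
  ∑ l, letter hbar l w • ladder l

theorem fieldCoeff_apply (w : Fin n → ℂ) (b : (Fin n → ℕ) → ℂ) :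
    fieldCoeff hbar w b = ∑ l, letter hbar l w • ladder l b := by
  simp [fieldCoeff]

theorem Rapid.fieldCoeff {b : (Fin n → ℕ) → ℂ} (hb : Rapid b) (w : Fin n → ℂ) :
    Rapid (fieldCoeff hbar w b) := by
  rw [fieldCoeff_apply]
  exact (rapidSubmodule n).sum_mem fun l _ => (rapidSubmodule n).smul_mem _ (hb.ladder l)

theorem Rapid.fieldCoeff_iterate {b : (Fin n → ℕ) → ℂ} (hb : Rapid b) (w : Fin n → ℂ) (r : ℕ) :
    Rapid ((WickBF.fieldCoeff hbar w)^[r] b) := by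
  induction r with
  | zero => exact hb
  | succ r ih =>
    rw [Function.iterate_succ_apply']
    exact ih.fieldCoeff w

theorem Rapid.fieldOp_antiSeries {b : (Fin n → ℕ) → ℂ} (hb : Rapid b) (w : Fin n → ℂ) :
    fieldOp hbar w (antiSeries b) = antiSeries (WickBF.fieldCoeff hbar w b) := by
  funext z
  rw [fieldCoeff_apply, antiSeries_sum _ _ fun l _ => (hb.ladder l).entire,
    Fintype.sum_sum_type, ← Finset.sum_add_distrib, fieldOp, Finset.sum_apply]
  refine Finset.sum_congr rfl fun i _ => ?_
  have h1 : antiSeries (WickBF.ladder (Sum.inl i) b) = dzbar i (antiSeries b) :=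
    hb.entire.antiSeries_lower i
  have h2 : antiSeries (WickBF.ladder (Sum.inr i) b) z = conj (z i) * antiSeries b z :=
    hb.entire.antiSeries_raise i z
  rw [h1, h2, letter_inl, letter_inr]
  simp only [Pi.sub_apply, Pi.smul_apply, smul_eq_mul, annih, creat]
  ring

theorem Rapid.fieldOp_iterate_antiSeries {b : (Fin n → ℕ) → ℂ} (hb : Rapid b) (w : Fin n → ℂ)
    (r : ℕ) : (fieldOp hbar w)^[r] (antiSeries b)
      = antiSeries ((WickBF.fieldCoeff hbar w)^[r] b) := by
  induction r with
  | zero => rfl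
  | succ r ih =>
    rw [Function.iterate_succ_apply', ih, (hb.fieldCoeff_iterate w r).fieldOp_antiSeries,
      Function.iterate_succ_apply']

/-- A product of ladder operators applied to a family of coefficients. -/
def word (b : (Fin n → ℕ) → ℂ) : (r : ℕ) → (Fin r → Fin n ⊕ Fin n) → (Fin n → ℕ) → ℂ
  | 0, _ => b
  | r + 1, s => ladder (s 0) (word b r fun k => s k.succ)

theorem Growth.word {C K : ℝ} (hC : 0 ≤ C) (hK : 1 ≤ K) {b : (Fin n → ℕ) → ℂ}
    (hb : Growth C K 0 b) : ∀ (r : ℕ) (s : Fin r → Fin n ⊕ Fin n), Growth C K r (word b r s)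
  | 0, _ => hb
  | r + 1, s => (Growth.word hC hK hb r _).ladder hC hK (s 0)

theorem Rapid.word {b : (Fin n → ℕ) → ℂ} (hb : Rapid b) :
    ∀ (r : ℕ) (s : Fin r → Fin n ⊕ Fin n), Rapid (word b r s)
  | 0, _ => hb
  | r + 1, s => (Rapid.word hb r _).ladder (s 0)

/-- The ladder operators do not all commute, so the power expands over words; the scalar
coefficients pull out by linearity. -/
theorem fieldCoeff_iterate_eq_sum (w : Fin n → ℂ) (b : (Fin n → ℕ) → ℂ) (r : ℕ) :
    (fieldCoeff hbar w)^[r] b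
      = ∑ s : Fin r → Fin n ⊕ Fin n, (∏ k, letter hbar (s k) w) • word b r s := by
  induction r with
  | zero => simp [word]
  | succ r ih =>
    rw [Function.iterate_succ_apply', ih, fieldCoeff_apply,
      ← (Fin.consEquiv fun _ : Fin (r + 1) => Fin n ⊕ Fin n).sum_comp, Fintype.sum_prod_type]
    refine Finset.sum_congr rfl fun l _ => ?_
    rw [map_sum, Finset.smul_sum]
    refine Finset.sum_congr rfl fun s _ => ?_
    rw [map_smul, smul_smul, Fin.prod_univ_succ]
    rfl

/-- The constants depend on `b` but not on the word. Growth of order only `√r!` is what the factor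
`1/r!` of the exponential series can beat. -/
theorem Rapid.exists_norm_word_le [hh : Fact (0 < hbar)] {b : (Fin n → ℕ) → ℂ} (hb : Rapid b) :
    ∃ A B : ℝ, 0 ≤ A ∧ 0 ≤ B ∧ ∀ (r : ℕ) (s : Fin r → Fin n ⊕ Fin n),
      ‖ofCoeff (WickBF.word b r s) ((hb.word r s).sqSummable hh.out)‖
        ≤ A * B ^ r * √(r.factorial) := by
  have h0 := hh.out
  -- Chosen so that `K / 2 ≥ 2 · 2ħ`, leaving `2^{-|N|}` against the weight `(2ħ)^|N|`, and so that
  -- `K ≥ 1`.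
  set K : ℝ := 8 * hbar + 1 with hKdef
  have hK : 1 ≤ K := by linarith
  obtain ⟨C, hC, hg⟩ := hb.exists_growth (zero_lt_one.trans_le hK)
  have hgeo := summable_geometric_deg (n := n) (r := 1 / 2) (by norm_num) (by norm_num)
  set G : ℝ := ∑' N : Fin n → ℕ, (1 / 2 : ℝ) ^ deg N with hG
  have hG0 : 0 ≤ G := tsum_nonneg fun N => by positivity
  refine ⟨√(C * G), √(2 * K), Real.sqrt_nonneg _, Real.sqrt_nonneg _, fun r s => ?_⟩
  refine (sq_le_sq₀ (norm_nonneg _) (by positivity)).1 ?_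
  rw [norm_ofCoeff_sq, mul_pow, mul_pow, Real.sq_sqrt (by positivity),
    Real.sq_sqrt (by positivity), ← pow_mul, mul_comm r 2, pow_mul, Real.sq_sqrt (by positivity),
    show C * G * (2 * K) ^ r * r.factorial = (C * (2 * K) ^ r * r.factorial) * G by ring, hG,
    ← tsum_mul_left]
  refine Summable.tsum_le_tsum (fun N => ?_) ((hb.word r s).sqSummable h0) (hgeo.mul_left _)
  have h1 := (hg.word hC hK r s).bound hC (zero_le_one.trans hK) N
  have h3 : (0 : ℝ) < (2 * hbar) ^ deg N := by positivity
  have h4 : (0 : ℝ) < mfact N := Nat.cast_pos.2 (mfact_pos N)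
  have h5 : (2 * (2 * hbar)) ^ deg N ≤ (K / 2) ^ deg N :=
    pow_le_pow_left₀ (by positivity) (by linarith) _
  have h6 := (mul_le_mul_of_nonneg_left h5 (sq_nonneg ‖WickBF.word b r s N‖)).trans h1
  rw [mul_pow] at h6
  rw [div_pow, kap_sq h0, div_div_eq_mul_div, div_le_iff₀ h4, one_div, inv_pow, mul_right_comm,
    ← div_eq_mul_inv, le_div_iff₀ (by positivity)]
  linarith

end Ladder

/-! ## The exponential series of the field operators -/

section Exponential

/-- Taylor's formula on `[0, 1]`: the remainder of order `k` is at most the bound for the derivative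
of order `k + 1` divided by `k!`. -/
theorem tendsto_taylor_partial_sum {g : ℕ → ℝ → ℂ} (hg : ∀ r t, HasDerivAt (g r) (g (r + 1) t) t)
    {B : ℕ → ℝ} (hB : ∀ r t, ‖g r t‖ ≤ B r)
    (hlim : Filter.Tendsto (fun k : ℕ => B (k + 1) / k.factorial) Filter.atTop (nhds 0)) :
    Filter.Tendsto (fun k => ∑ r ∈ Finset.range (k + 1), (r.factorial : ℂ)⁻¹ * g r 0)
      Filter.atTop (nhds (g 0 1)) := by
  have hiter : ∀ r, iteratedDeriv r (g 0) = g r := by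
    intro r
    induction r with
    | zero => exact iteratedDeriv_zero
    | succ r ih =>
      rw [iteratedDeriv_succ, ih]
      exact funext fun t => (hg r t).deriv
  have hcd : ContDiff ℝ ((⊤ : ℕ∞) : WithTop ℕ∞) (g 0) := by
    refine contDiff_of_differentiable_iteratedDeriv fun m _ => ?_
    rw [hiter]
    exact fun t => (hg m t).differentiableAt
  have hwithin : ∀ r, ∀ t ∈ Set.Icc (0 : ℝ) 1,
      iteratedDerivWithin r (g 0) (Set.Icc 0 1) t = g r t := by
    intro r t ht
    rw [iteratedDerivWithin_eq_iteratedDeriv (uniqueDiffOn_Icc zero_lt_one)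
      (hcd.contDiffAt.of_le (by exact_mod_cast le_top)) ht, hiter]
  have htaylor : ∀ k, taylorWithinEval (g 0) k (Set.Icc 0 1) 0 1
      = ∑ r ∈ Finset.range (k + 1), (r.factorial : ℂ)⁻¹ * g r 0 := by
    intro k
    rw [taylor_within_apply]
    refine Finset.sum_congr rfl fun r _ => ?_
    rw [hwithin r 0 (Set.left_mem_Icc.2 zero_le_one), sub_zero, one_pow, mul_one, Complex.real_smul]
    push_cast
    rfl
  rw [tendsto_iff_norm_sub_tendsto_zero]
  refine squeeze_zero (fun _ => norm_nonneg _) (fun k => ?_) hlim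
  rw [norm_sub_rev, ← htaylor]
  have h := taylor_mean_remainder_bound (f := g 0) (n := k) zero_le_one
    (hcd.of_le (by exact_mod_cast le_top)).contDiffOn (Set.right_mem_Icc.2 zero_le_one)
    (C := B (k + 1)) fun t ht => by
      rw [hwithin _ t ht]
      exact hB _ t
  simpa using h

variable {n : ℕ} {hbar : ℝ}

theorem Entire.hasDerivAt_line {b : (Fin n → ℕ) → ℂ} (hb : Entire b) (z w : Fin n → ℂ) (t : ℝ) :
    HasDerivAt (fun t : ℝ => antiSeries b (z + (t : ℂ) • w))
      (∑ i, conj (w i) * dzbar i (antiSeries b) (z + (t : ℂ) • w)) t := by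
  have h1 : HasDerivAt (fun t : ℝ => z + (t : ℂ) • w) w t := by
    have := (Complex.ofRealCLM.hasDerivAt (x := t)).smul_const w
    simpa using this.const_add z
  have h2 := (hb.hasFDerivAt_antiSeries (z + (t : ℂ) • w)).comp_hasDerivAt t h1
  rw [← (hb.hasFDerivAt_antiSeries _).fderiv, hb.fderiv_antiSeries] at h2
  simp only [hb.dzbar_antiSeries]
  exact h2

/-- The derivative of the Gaussian exponent is `-∑ w (z̄ + t w̄) / 2ħ`, the creation part evaluated
at the translated point; differentiating the translation gives the annihilation part. -/
theorem Rapid.hasDerivAt_act [hh : Fact (0 < hbar)] {b : (Fin n → ℕ) → ℂ} (hb : Rapid b)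
    (w z : Fin n → ℂ) (t : ℝ) :
    HasDerivAt (fun t : ℝ => actFun hbar ⟨(t : ℂ) • w, 0⟩ (antiSeries b) z)
      (1 / (2 * hbar) * actFun hbar ⟨(t : ℂ) • w, 0⟩ (antiSeries (WickBF.fieldCoeff hbar w b)) z)
      t := by
  have hne : (hbar : ℂ) ≠ 0 := Complex.ofReal_ne_zero.2 hh.out.ne'
  set A : ℂ := ∑ i, conj (w i) * w i with hA
  set Z : ℂ := ∑ i, w i * conj (z i) with hZ
  have hact : ∀ (s : ℝ) (ψ : (Fin n → ℂ) → ℂ), actFun hbar ⟨(s : ℂ) • w, 0⟩ ψ z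
      = Complex.exp (-(s : ℂ) ^ 2 * (A / (4 * hbar)) - s * (Z / (2 * hbar))) *
        ψ (z + (s : ℂ) • w) := by
    intro s ψ
    unfold actFun
    rw [← Complex.exp_add]
    congr 2
    simp only [Pi.smul_apply, smul_eq_mul, map_mul, Complex.conj_ofReal, Complex.ofReal_zero,
      mul_zero, zero_sub, hA, hZ, neg_div, Finset.sum_div, Finset.mul_sum,
      ← Finset.sum_neg_distrib, ← Finset.sum_add_distrib, ← Finset.sum_sub_distrib]
    refine Finset.sum_congr rfl fun i _ => ?_
    ring
  simp only [hact]
  have hofReal : HasDerivAt (fun s : ℝ => (s : ℂ)) 1 t := Complex.ofRealCLM.hasDerivAt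
  set E := Complex.exp (-(t : ℂ) ^ 2 * (A / (4 * hbar)) - t * (Z / (2 * hbar))) with hE
  have hexp : HasDerivAt (fun s : ℝ =>
      Complex.exp (-(s : ℂ) ^ 2 * (A / (4 * hbar)) - s * (Z / (2 * hbar))))
      (E * (-(2 * t) * (A / (4 * hbar)) - Z / (2 * hbar))) t := by
    refine HasDerivAt.congr_deriv (((((hofReal.pow 2).neg).mul_const (A / (4 * hbar))).sub
      (hofReal.mul_const (Z / (2 * hbar)))).cexp) ?_
    change E * _ = _
    push_cast
    ring
  have h : HasDerivAt (fun s : ℝ =>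
      Complex.exp (-(s : ℂ) ^ 2 * (A / (4 * hbar)) - s * (Z / (2 * hbar))) *
        antiSeries b (z + (s : ℂ) • w)) _ t := hexp.mul (hb.entire.hasDerivAt_line z w t)
  refine h.congr_deriv ?_
  rw [← hb.fieldOp_antiSeries]
  have hf : fieldOp hbar w (antiSeries b) (z + (t : ℂ) • w)
      = 2 * hbar * (∑ i, conj (w i) * dzbar i (antiSeries b) (z + (t : ℂ) • w))
        - (Z + t * A) * antiSeries b (z + (t : ℂ) • w) := by
    rw [fieldOp, Finset.sum_apply, hZ, hA, Finset.mul_sum, Finset.mul_sum,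
      ← Finset.sum_add_distrib, Finset.sum_mul, ← Finset.sum_sub_distrib]
    refine Finset.sum_congr rfl fun i _ => ?_
    simp only [Pi.sub_apply, Pi.smul_apply, smul_eq_mul, annih, creat, Pi.add_apply, map_add,
      map_mul, Complex.conj_ofReal]
    ring
  rw [hf, ← hE]
  clear_value E
  field_simp
  ring

end Exponential

/-! ### Convergence of the exponential series and analytic vectors -/

section AnalyticVectors

variable {n : ℕ} {hbar : ℝ}

/-- Writing the term as `(1/2)^r` times `(2|x|)^r / √r!`, the product is at most the sum of the
squares, a geometric and an exponential series. -/
theorem summable_pow_div_sqrt_factorial (x : ℝ) :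
    Summable fun r : ℕ => x ^ r / √(r.factorial) := by
  have h1 : Summable fun r : ℕ => (1 / 4 : ℝ) ^ r :=
    summable_geometric_of_lt_one (by norm_num) (by norm_num)
  refine Summable.of_norm_bounded
    (h1.add (Real.summable_pow_div_factorial (4 * x ^ 2))) fun r => ?_
  have e1 : (1 / 4 : ℝ) ^ r = ((1 / 2 : ℝ) ^ r) ^ 2 := by
    rw [← pow_mul, mul_comm, pow_mul]
    norm_num
  have e2 : (4 * x ^ 2) ^ r / (r.factorial : ℝ) = ((2 * |x|) ^ r / √(r.factorial)) ^ 2 := by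
    rw [div_pow, Real.sq_sqrt (by positivity), ← pow_mul, mul_comm r 2, pow_mul (2 * |x|), mul_pow 2,
      sq_abs]
    norm_num
  have e3 : ‖x ^ r / √(r.factorial)‖ = (1 / 2 : ℝ) ^ r * ((2 * |x|) ^ r / √(r.factorial)) := by
    rw [norm_div, norm_pow, Real.norm_eq_abs, Real.norm_of_nonneg (Real.sqrt_nonneg _),
      mul_div_assoc', ← mul_pow]
    congr 2
    ring
  rw [e1, e2, e3]
  nlinarith [sq_nonneg ((1 / 2 : ℝ) ^ r - (2 * |x|) ^ r / √(r.factorial)),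
    sq_nonneg ((1 / 2 : ℝ) ^ r), sq_nonneg ((2 * |x|) ^ r / √(r.factorial))]

/-- The coefficient `(1/r!) (1/2ħ)^r` of the exponential series. -/
def expCoeff (hbar : ℝ) (r : ℕ) : ℂ := (r.factorial : ℂ)⁻¹ * (1 / (2 * (hbar : ℂ))) ^ r

theorem norm_expCoeff (hh : 0 < hbar) (r : ℕ) :
    ‖expCoeff hbar r‖ = (r.factorial : ℝ)⁻¹ * (1 / (2 * hbar)) ^ r := by
  simp [expCoeff, abs_of_pos hh]

/-- The vector obtained by applying a product of ladder operators. -/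
def wordVec [hh : Fact (0 < hbar)] {b : (Fin n → ℕ) → ℂ} (hb : Rapid b) (r : ℕ)
    (s : Fin r → Fin n ⊕ Fin n) : HBF n hbar :=
  ofCoeff (word b r s) ((hb.word r s).sqSummable hh.out)

theorem wordVec_fn [hh : Fact (0 < hbar)] {b : (Fin n → ℕ) → ℂ} (hb : Rapid b) (r : ℕ)
    (s : Fin r → Fin n ⊕ Fin n) : (wordVec (hbar := hbar) hb r s).fn = antiSeries (word b r s) :=
  ofCoeff_fn _ _

/-- The exponential series of the field operators applied to a vector, as a power series in
`w`. -/
def orbitSeries (hbar : ℝ) [Fact (0 < hbar)] {b : (Fin n → ℕ) → ℂ} (hb : Rapid b) :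
    FormalMultilinearSeries ℝ (Fin n → ℂ) (HBF n hbar) := fun r =>
  ∑ s : Fin r → Fin n ⊕ Fin n,
    ((ContinuousLinearMap.toSpanSingleton ℂ
      (expCoeff hbar r • wordVec (hbar := hbar) hb r s)).restrictScalars ℝ
        ).compContinuousMultilinearMap
      ((ContinuousMultilinearMap.mkPiAlgebra ℝ (Fin r) ℂ).compContinuousLinearMap
        fun k => letter hbar (s k))

theorem orbitSeries_apply [Fact (0 < hbar)] {b : (Fin n → ℕ) → ℂ} (hb : Rapid b) (r : ℕ)
    (m : Fin r → Fin n → ℂ) :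
    orbitSeries hbar hb r m = ∑ s : Fin r → Fin n ⊕ Fin n,
      (∏ k, letter hbar (s k) (m k)) • expCoeff hbar r • wordVec (hbar := hbar) hb r s := by
  simp [orbitSeries]

theorem orbitSeries_fn [Fact (0 < hbar)] {b : (Fin n → ℕ) → ℂ} (hb : Rapid b) (r : ℕ)
    (w : Fin n → ℂ) :
    (orbitSeries hbar hb r fun _ => w).fn
      = expCoeff hbar r • (fieldOp hbar w)^[r] (antiSeries b) := by
  rw [orbitSeries_apply, hb.fieldOp_iterate_antiSeries, fieldCoeff_iterate_eq_sum, HBF.fn_sum]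
  funext z
  rw [Finset.sum_apply, Pi.smul_apply, antiSeries_sum _ _ fun s _ => (hb.word r s).entire,
    smul_eq_mul, Finset.mul_sum]
  refine Finset.sum_congr rfl fun s _ => ?_
  rw [HBF.fn_smul, HBF.fn_smul, wordVec_fn]
  simp only [Pi.smul_apply, smul_eq_mul]
  ring

/-- There are `(2n)^r` words of length `r`, each of norm at most `A B^r √r!`, and `√r! / r! = 1 /
√r!`. -/
theorem exists_norm_orbitSeries_le [hh : Fact (0 < hbar)] {b : (Fin n → ℕ) → ℂ} (hb : Rapid b) :
    ∃ A Q : ℝ, 0 ≤ A ∧ 0 ≤ Q ∧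
      ∀ r, ‖orbitSeries hbar hb r‖ ≤ A * (Q ^ r / √(r.factorial)) := by
  have h0 := hh.out
  obtain ⟨A, B, hA, hB, hAB⟩ := hb.exists_norm_word_le (hbar := hbar)
  set c : ℝ := ((Fintype.card (Fin n ⊕ Fin n) : ℕ) : ℝ) with hc
  refine ⟨A, c * ((2 * hbar + 1) * (1 / (2 * hbar)) * B), hA, by positivity, fun r => ?_⟩
  have hf : (0 : ℝ) < r.factorial := Nat.cast_pos.2 r.factorial_pos
  refine ContinuousMultilinearMap.opNorm_le_bound (by positivity) fun m => ?_
  rw [orbitSeries_apply]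
  have hterm : ∀ s : Fin r → Fin n ⊕ Fin n,
      ‖(∏ k, letter hbar (s k) (m k)) • expCoeff hbar r • wordVec (hbar := hbar) hb r s‖
        ≤ ((2 * hbar + 1) ^ r * ∏ k, ‖m k‖) * (((r.factorial : ℝ)⁻¹ * (1 / (2 * hbar)) ^ r) *
          (A * B ^ r * √(r.factorial))) := by
    intro s
    rw [norm_smul, norm_smul, norm_expCoeff h0, norm_prod]
    have h1 : ∏ k, ‖letter hbar (s k) (m k)‖ ≤ (2 * hbar + 1) ^ r * ∏ k, ‖m k‖ := by
      refine (Finset.prod_le_prod (fun _ _ => norm_nonneg _)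
        fun k _ => norm_letter_le h0 (s k) (m k)).trans (le_of_eq ?_)
      rw [Finset.prod_mul_distrib, Finset.prod_const, Finset.card_univ, Fintype.card_fin]
    have h2 := hAB r s
    gcongr
    exact h2
  refine (norm_sum_le_of_le _ fun s _ => hterm s).trans (le_of_eq ?_)
  rw [Finset.sum_const, Finset.card_univ, Fintype.card_fun, Fintype.card_fin, nsmul_eq_mul,
    Nat.cast_pow, ← hc]
  have hs : (r.factorial : ℝ)⁻¹ * √(r.factorial) = 1 / √(r.factorial) := by
    rw [inv_mul_eq_div, Real.sqrt_div_self']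
  rw [div_eq_mul_one_div _ √(r.factorial : ℝ), ← hs]
  simp only [mul_pow]
  ring

theorem summable_norm_orbitSeries [Fact (0 < hbar)] {b : (Fin n → ℕ) → ℂ} (hb : Rapid b)
    {x : ℝ} (hx : 0 ≤ x) : Summable fun r => ‖orbitSeries hbar hb r‖ * x ^ r := by
  obtain ⟨A, Q, hA, hQ, h⟩ := exists_norm_orbitSeries_le (hbar := hbar) hb
  refine ((summable_pow_div_sqrt_factorial (Q * x)).mul_left A).of_nonneg_of_le
    (fun r => by positivity) fun r => ?_
  refine (mul_le_mul_of_nonneg_right (h r) (pow_nonneg hx r)).trans (le_of_eq ?_)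
  rw [mul_pow]
  ring

theorem actFun_smul (g : Heis n) (c : ℂ) (ψ : (Fin n → ℂ) → ℂ) :
    actFun hbar g (c • ψ) = c • actFun hbar g ψ :=
  funext fun _ => mul_left_comm _ _ _

theorem norm_orbitSeries_apply_le [Fact (0 < hbar)] {b : (Fin n → ℕ) → ℂ} (hb : Rapid b)
    (w : Fin n → ℂ) (r : ℕ) :
    ‖orbitSeries hbar hb r fun _ => w‖ ≤ ‖orbitSeries hbar hb r‖ * ‖w‖ ^ r := by
  refine ((orbitSeries hbar hb r).le_opNorm _).trans (le_of_eq ?_)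
  rw [Finset.prod_const, Finset.card_univ, Fintype.card_fin]

theorem tendsto_orbitSeries_apply [hh : Fact (0 < hbar)] {b : (Fin n → ℕ) → ℂ} (hb : Rapid b)
    (w z : Fin n → ℂ) :
    Filter.Tendsto (fun k => ∑ r ∈ Finset.range (k + 1), (orbitSeries hbar hb r fun _ => w).fn z)
      Filter.atTop (nhds (actFun hbar ⟨w, 0⟩ (antiSeries b) z)) := by
  obtain ⟨C, hC⟩ := HBF.norm_apply_le (hbar := hbar) z
  -- The successive derivatives of `t ↦ (U_{tw} ψ)(z)`. Each is also the value at `z` of a unitary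
  -- image of `r!` times the `r`-th term of the series, hence bounded uniformly in `t`.
  let g : ℕ → ℝ → ℂ := fun r t => (1 / (2 * (hbar : ℂ))) ^ r *
    actFun hbar ⟨(t : ℂ) • w, 0⟩ (antiSeries ((fieldCoeff hbar w)^[r] b)) z
  have hgU : ∀ r t, g r t = (U n hbar ⟨(t : ℂ) • w, 0⟩
      ((r.factorial : ℂ) • orbitSeries hbar hb r fun _ => w)).fn z := by
    intro r t
    rw [U_fn, HBF.fn_smul, orbitSeries_fn, hb.fieldOp_iterate_antiSeries, smul_smul, actFun_smul,
      Pi.smul_apply, smul_eq_mul, expCoeff, mul_inv_cancel_left₀ (Nat.cast_ne_zero.2 r.factorial_ne_zero)]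
  have hg : ∀ r t, HasDerivAt (g r) (g (r + 1) t) t := by
    intro r t
    refine (((hb.fieldCoeff_iterate w r).hasDerivAt_act w z t).const_mul
      ((1 / (2 * (hbar : ℂ))) ^ r)).congr_deriv ?_
    simp only [g]
    rw [Function.iterate_succ_apply', pow_succ, mul_assoc]
  have hbound : ∀ r t, ‖g r t‖ ≤ C * (r.factorial * ‖orbitSeries hbar hb r fun _ => w‖) := by
    intro r t
    rw [hgU]
    refine (hC _).trans (le_of_eq ?_)
    rw [LinearIsometryEquiv.norm_map, norm_smul, Complex.norm_natCast]
  -- Tested on the unit vector `mono hbar 0`.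
  have hC0 : 0 ≤ C := by
    by_contra hneg
    have h := hC (mono hbar 0)
    rw [(orthonormal_mono n hbar).1, mul_one] at h
    exact hneg ((norm_nonneg _).trans h)
  have hlim : Filter.Tendsto (fun k : ℕ => C * ((k + 1).factorial *
      ‖orbitSeries hbar hb (k + 1) fun _ => w‖) / k.factorial) Filter.atTop (nhds 0) := by
    -- The remainder carries a factor `(k + 1)! / k! = k + 1 ≤ 2^(k + 1)`, absorbed by summability
    -- at the radius `2‖w‖`.
    have h1 := ((summable_norm_orbitSeries (hbar := hbar) hb (x := 2 * ‖w‖)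
      (by positivity)).tendsto_atTop_zero.comp (Filter.tendsto_add_atTop_nat 1)).const_mul C
    rw [mul_zero] at h1
    refine squeeze_zero (fun k => by positivity) (fun k => ?_) h1
    have hf : (k.factorial : ℝ) ≠ 0 := Nat.cast_ne_zero.2 k.factorial_ne_zero
    have e : C * ((k + 1).factorial * ‖orbitSeries hbar hb (k + 1) fun _ => w‖) / k.factorial
        = C * (((k + 1 : ℕ) : ℝ) * ‖orbitSeries hbar hb (k + 1) fun _ => w‖) := by
      rw [Nat.factorial_succ]
      push_cast
      field_simp
    rw [e]
    have h2 := norm_orbitSeries_apply_le (hbar := hbar) hb w (k + 1)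
    have h3 : ((k + 1 : ℕ) : ℝ) ≤ 2 ^ (k + 1) := by exact_mod_cast Nat.lt_two_pow_self.le
    calc C * (((k + 1 : ℕ) : ℝ) * ‖orbitSeries hbar hb (k + 1) fun _ => w‖)
        ≤ C * (2 ^ (k + 1) * (‖orbitSeries hbar hb (k + 1)‖ * ‖w‖ ^ (k + 1))) := by gcongr
      _ = _ := by
          simp only [Function.comp_apply, mul_pow]
          ring
  have h := tendsto_taylor_partial_sum hg hbound hlim
  have e1 : g 0 1 = actFun hbar ⟨w, 0⟩ (antiSeries b) z := by
    simp [g]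
  rw [e1] at h
  refine h.congr fun k => Finset.sum_congr rfl fun r _ => ?_
  rw [hgU, map_smul, HBF.fn_smul, Pi.smul_apply, smul_eq_mul,
    inv_mul_cancel_left₀ (Nat.cast_ne_zero.2 r.factorial_ne_zero)]
  have e2 : (⟨((0 : ℝ) : ℂ) • w, 0⟩ : Heis n) = 1 := by
    rw [Complex.ofReal_zero, zero_smul]
    rfl
  rw [e2, map_one]
  rfl

/-- Absolute convergence provides a limit `S` in norm. Evaluation at a point is bounded, so `S` is
also the pointwise limit, already identified by Taylor's formula. -/
theorem hasSum_orbitSeries [Fact (0 < hbar)] {b : (Fin n → ℕ) → ℂ} (hb : Rapid b)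
    {ψ : HBF n hbar} (hψ : ψ.fn = antiSeries b) (w : Fin n → ℂ) :
    HasSum (fun r => orbitSeries hbar hb r fun _ => w) (U n hbar ⟨w, 0⟩ ψ) := by
  have hs : Summable fun r => orbitSeries hbar hb r fun _ => w :=
    Summable.of_norm_bounded (summable_norm_orbitSeries hb (norm_nonneg w))
      (norm_orbitSeries_apply_le hb w)
  obtain ⟨S, hS⟩ := hs
  suffices h : S = U n hbar ⟨w, 0⟩ ψ from h ▸ hS
  apply HBF.ext'
  funext z
  rw [U_fn, hψ]
  refine tendsto_nhds_unique ?_ (tendsto_orbitSeries_apply (hbar := hbar) hb w z)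
  obtain ⟨C, hC⟩ := HBF.norm_apply_le (hbar := hbar) z
  have h1 := (hS.tendsto_sum_nat.comp (Filter.tendsto_add_atTop_nat 1))
  rw [tendsto_iff_norm_sub_tendsto_zero] at h1 ⊢
  have h2 := h1.const_mul C
  rw [mul_zero] at h2
  refine squeeze_zero (fun _ => norm_nonneg _) (fun k => ?_) h2
  rw [← Finset.sum_apply, ← HBF.fn_sum]
  exact hC ((∑ r ∈ Finset.range (k + 1), orbitSeries hbar hb r fun _ => w) - S)

theorem hasFPowerSeriesOnBall_orbit [Fact (0 < hbar)] {b : (Fin n → ℕ) → ℂ} (hb : Rapid b)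
    {ψ : HBF n hbar} (hψ : ψ.fn = antiSeries b) :
    HasFPowerSeriesOnBall (fun w : Fin n → ℂ => U n hbar ⟨w, 0⟩ ψ) (orbitSeries hbar hb) 0 ⊤ where
  r_le := by
    rw [FormalMultilinearSeries.radius_eq_top_of_summable_norm]
    exact fun x => summable_norm_orbitSeries hb x.2
  r_pos := ENNReal.coe_lt_top
  hasSum := fun {w} _ => by
    rw [zero_add]
    exact hasSum_orbitSeries hb hψ w

theorem isAnalyticVector_of_rapid [Fact (0 < hbar)] {b : (Fin n → ℕ) → ℂ} (hb : Rapid b)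
    {ψ : HBF n hbar} (hψ : ψ.fn = antiSeries b) : IsAnalyticVector (U n hbar) ψ := by
  -- The centre acts by a phase, which reduces analyticity on the group to analyticity in `w`.
  have hfac : (fun x : (Fin n → ℂ) × ℝ => U n hbar ⟨x.1, x.2⟩ ψ) = fun x =>
      Complex.exp (-(Complex.I / (2 * hbar)) * x.2) • U n hbar ⟨x.1, 0⟩ ψ := by
    funext x
    apply HBF.ext'
    funext z
    rw [HBF.fn_smul, Pi.smul_apply, U_fn, U_fn, actFun, actFun, smul_eq_mul, sub_eq_add_neg,
      Complex.exp_add]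
    simp only [Complex.ofReal_zero, mul_zero, zero_sub]
    ring
  unfold IsAnalyticVector
  rw [hfac]
  intro x _
  have h1 : AnalyticAt ℝ (fun x : (Fin n → ℂ) × ℝ => U n hbar ⟨x.1, 0⟩ ψ) x := by
    refine AnalyticAt.fun_comp (g := fun w : Fin n → ℂ => U n hbar ⟨w, 0⟩ ψ) ?_ analyticAt_fst
    exact (hasFPowerSeriesOnBall_orbit hb hψ).analyticAt_of_mem (by simp)
  have h2 : AnalyticAt ℝ (fun x : (Fin n → ℂ) × ℝ =>
      Complex.exp (-(Complex.I / (2 * hbar)) * x.2)) x := by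
    have h3 : AnalyticAt ℝ (fun x : (Fin n → ℂ) × ℝ => (x.2 : ℂ)) x :=
      (Complex.ofRealCLM.analyticAt _).fun_comp analyticAt_snd
    have h4 := analyticAt_const (𝕜 := ℝ) (v := -(Complex.I / (2 * (hbar : ℂ)))) (x := x) |>.mul h3
    exact AnalyticAt.fun_comp (g := Complex.exp)
      (AnalyticAt.restrictScalars (𝕜 := ℝ) analyticAt_cexp) h4
  exact h2.smul h1

end AnalyticVectors

/-! ## The Bargmann-Fock representation of the Heisenberg functions -/

section Representation

variable {n : ℕ} {hbar : ℝ}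

/-- The function `A exp(a z + β z̄)`. -/
def planeWave (A : ℂ) (a β : Fin n → ℂ) : (Fin n → ℂ) → ℂ := fun z =>
  A * Complex.exp (∑ i, (a i * z i + β i * conj (z i)))

theorem fderiv_planeWave (A : ℂ) (a β z v : Fin n → ℂ) :
    fderiv ℝ (planeWave A a β) z v
      = planeWave A a β z * ∑ i, (a i * v i + β i * conj (v i)) := by
  let L : (Fin n → ℂ) →L[ℝ] ℂ := ∑ i, (a i • ContinuousLinearMap.proj i +
    β i • (Complex.conjCLE : ℂ →L[ℝ] ℂ).comp (ContinuousLinearMap.proj i))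
  have hL : ∀ u, L u = ∑ i, (a i * u i + β i * conj (u i)) := by
    intro u
    simp [L]
  have h : HasFDerivAt (planeWave A a β) (A • (Complex.exp (L z) • L)) z := by
    have e : planeWave A a β = fun u => A * Complex.exp (L u) := by
      funext u
      rw [hL]
      rfl
    rw [e]
    exact (L.hasFDerivAt.cexp).const_mul A
  rw [h.fderiv]
  change A * (Complex.exp (L z) * L v) = _
  rw [hL, hL, planeWave]
  ring

theorem fderiv_planeWave_single (A : ℂ) (a β z : Fin n → ℂ) (i : Fin n) (c : ℂ) :
    fderiv ℝ (planeWave A a β) z (Pi.single i c)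
      = planeWave A a β z * (a i * c + β i * conj c) := by
  rw [fderiv_planeWave, Finset.sum_eq_single i]
  · simp
  · intro j _ hj
    simp [Pi.single_eq_of_ne hj]
  · simp

theorem dz_planeWave (A : ℂ) (a β : Fin n → ℂ) (i : Fin n) :
    dz i (planeWave A a β) = planeWave (A * a i) a β := by
  funext z
  simp only [dz, fderiv_planeWave_single, map_one, Complex.conj_I, planeWave]
  linear_combination (A * Complex.exp (∑ i, (a i * z i + β i * conj (z i))) *
    (1 / 2) * (β i - a i)) * Complex.I_mul_I

theorem dzbar_planeWave (A : ℂ) (a β : Fin n → ℂ) (i : Fin n) :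
    dzbar i (planeWave A a β) = planeWave (A * β i) a β := by
  funext z
  simp only [dzbar, fderiv_planeWave_single, map_one, Complex.conj_I, planeWave]
  linear_combination (A * Complex.exp (∑ i, (a i * z i + β i * conj (z i))) *
    (1 / 2) * (a i - β i)) * Complex.I_mul_I

/-- The operators `d i` are kept abstract, with eigenvalues `y i`, so that `∂/∂z` and `∂/∂z̄` are
treated at once. -/
theorem foldr_iterate_planeWave {a β y : Fin n → ℂ}
    {d : Fin n → ((Fin n → ℂ) → ℂ) → (Fin n → ℂ) → ℂ}
    (hd : ∀ i A, d i (planeWave A a β) = planeWave (A * y i) a β) (A : ℂ) (R : Fin n → ℕ) :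
    (List.finRange n).foldr (fun i g => (d i)^[R i] g) (planeWave A a β)
      = planeWave (A * ∏ i, y i ^ R i) a β := by
  have hit : ∀ i k B, (d i)^[k] (planeWave B a β) = planeWave (B * y i ^ k) a β := by
    intro i k B
    induction k with
    | zero => simp
    | succ k ih => rw [Function.iterate_succ_apply', ih, hd, pow_succ, mul_assoc]
  have key : ∀ l : List (Fin n), l.foldr (fun i g => (d i)^[R i] g) (planeWave A a β)
      = planeWave (A * (l.map fun i => y i ^ R i).prod) a β := by
    intro l
    induction l with
    | nil => simp
    | cons i l ih =>
      rw [List.foldr_cons, ih, hit, List.map_cons, List.prod_cons]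
      congr 1
      ring
  rw [key, ← List.ofFn_eq_map, List.prod_ofFn]

theorem dzPow_planeWave (A : ℂ) (a β : Fin n → ℂ) (R : Fin n → ℕ) :
    dzPow R (planeWave A a β) = planeWave (A * ∏ i, a i ^ R i) a β :=
  foldr_iterate_planeWave (fun i A => dz_planeWave A a β i) A R

theorem dzbarPow_planeWave (A : ℂ) (a β : Fin n → ℂ) (S : Fin n → ℕ) :
    dzbarPow S (planeWave A a β) = planeWave (A * ∏ i, β i ^ S i) a β :=
  foldr_iterate_planeWave (fun i A => dzbar_planeWave A a β i) A S

theorem Psi_planeWave (A : ℂ) (a β z : Fin n → ℂ) :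
    Psi (planeWave A a β) z = A * Complex.exp (∑ i, β i * conj (z i)) := by
  rw [← antiSeries_exp, Psi_eq_antiSeries]
  unfold antiSeries expSeries
  rw [← tsum_mul_left]
  refine tsum_congr fun N => ?_
  simp only [dzbarPow_planeWave, planeWave, Pi.zero_apply, map_zero, mul_zero, add_zero, Finset.sum_const_zero,
    Complex.exp_zero]
  ring

theorem heisFun_eq_planeWave (hbar : ℝ) (g : Heis n) :
    heisFun hbar g = planeWave (Complex.exp (-(Complex.I / (2 * hbar)) * g.c) *
      Complex.exp (hbar * ∑ i, conj (g.w i / (2 * hbar)) * (-g.w i / (2 * hbar))))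
      (fun i => conj (g.w i / (2 * hbar))) (fun i => -g.w i / (2 * hbar)) := by
  funext z
  simp only [heisFun, expFun, planeWave]
  ring

/-- Each `∂_z^I` multiplies the exponential by `(w̄ / 2ħ)^I`, cancelling `(2ħ)^|I|`. What remains is
a fixed prefactor, the one of `actFun`, times the Taylor series of `ψ` at `z̄` with increment `w̄`;
the normalization of `expFun` supplies the factor `exp(-w̄w / 4ħ)`. -/
theorem hasSum_bfRepTerm_heisFun [hh : Fact (0 < hbar)] {b : (Fin n → ℕ) → ℂ} (hb : Entire b)
    (g : Heis n) (z : Fin n → ℂ) :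
    HasSum (fun I : Fin n → ℕ => bfRepTerm hbar (heisFun hbar g) (antiSeries b) I z)
      (actFun hbar g (antiSeries b) z) := by
  have hne : (hbar : ℂ) ≠ 0 := Complex.ofReal_ne_zero.2 hh.out.ne'
  have hT := hb.hasSum_taylor (fun i => conj (z i)) (fun i => conj (g.w i))
  have e0 : expSeries b ((fun i => conj (z i)) + fun i => conj (g.w i))
      = antiSeries b (z + g.w) := by
    unfold antiSeries
    congr 1
    funext i
    simp
  rw [e0] at hT
  have h := hT.mul_left (Complex.exp (-(Complex.I / (2 * hbar)) * g.c
    - (∑ i, conj (g.w i) * g.w i) / (4 * hbar)) *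
    Complex.exp (-(∑ i, g.w i * conj (z i)) / (2 * hbar)))
  refine h.congr_fun fun I => ?_
  rw [bfRepTerm, heisFun_eq_planeWave, dzPow_planeWave, Psi_planeWave, hb.dzbarPow_antiSeries]
  have e1 : (∑ i, -g.w i / (2 * hbar) * conj (z i)) = -(∑ i, g.w i * conj (z i)) / (2 * hbar) := by
    rw [← Finset.sum_neg_distrib, Finset.sum_div]
    exact Finset.sum_congr rfl fun i _ => by ring
  have e2 : hbar * ∑ i, conj (g.w i / (2 * hbar)) * (-g.w i / (2 * hbar))
      = -((∑ i, conj (g.w i) * g.w i) / (4 * hbar)) := by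
    rw [Finset.mul_sum, Finset.sum_div, ← Finset.sum_neg_distrib]
    refine Finset.sum_congr rfl fun i _ => ?_
    simp only [map_div₀, map_mul, Complex.conj_ofReal, map_ofNat]
    field_simp
    ring
  have e3 : ∏ i, conj (g.w i / (2 * hbar)) ^ I i
      = (∏ i, conj (g.w i) ^ I i) / (2 * (hbar : ℂ)) ^ deg I := by
    simp only [map_div₀, map_mul, Complex.conj_ofReal, map_ofNat, div_pow, Finset.prod_div_distrib,
      prod_pow_eq_pow_deg]
  rw [e1, e2, e3, ← Complex.exp_add, ← sub_eq_add_neg]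
  have h1 : (2 * (hbar : ℂ)) ^ deg I ≠ 0 := pow_ne_zero _ (mul_ne_zero two_ne_zero hne)
  have e4 : antiSeries (shift I b) z = expSeries (shift I b) fun i => conj (z i) := rfl
  rw [e4]
  push_cast
  field_simp

end Representation

end WickBF

end

/-! ### Elements of 𝔇 as analytic vectors of the Heisenberg representation -/

theorem mainTheorem12 (n : ℕ) (hbar : ℝ) [Fact (0 < hbar)] :
    (∀ φ ∈ WickBF.D n hbar, φ ∈ WickBF.bfSpace n hbar) ∧
    Dense {ψ : WickBF.HBF n hbar | ψ.fn ∈ WickBF.D n hbar} ∧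
    ∀ ψ : WickBF.HBF n hbar, ψ.fn ∈ WickBF.D n hbar →
      (∀ (g : WickBF.Heis n) (z : Fin n → ℂ),
        HasSum (fun I : Fin n → ℕ => WickBF.bfRepTerm hbar (WickBF.heisFun hbar g) ψ.fn I z)
          ((WickBF.U n hbar g ψ).fn z)) ∧
      WickBF.IsAnalyticVector (WickBF.U n hbar) ψ ∧
      ∀ w : Fin n → ℂ, ∃ φ : ℕ → WickBF.HBF n hbar,
        (∀ r : ℕ, (φ r).fn =
          ((r.factorial : ℂ)⁻¹ * (1 / (2 * (hbar : ℂ))) ^ r) •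
            (WickBF.fieldOp hbar w)^[r] ψ.fn) ∧
        HasSum φ (WickBF.U n hbar ⟨w, 0⟩ ψ) := by
  refine ⟨WickBF.D_subset_bfSpace n hbar, WickBF.dense_D n hbar, fun ψ hψ => ?_⟩
  -- From here on only the rapid decay of the Taylor coefficients of `ψ` matters.
  obtain ⟨b, hb, hψb⟩ := WickBF.exists_rapid_of_mem_D Fact.out hψ
  refine ⟨fun g z => ?_, WickBF.isAnalyticVector_of_rapid hb hψb, fun w =>
    ⟨fun r => WickBF.orbitSeries hbar hb r fun _ => w, fun r => ?_,
      WickBF.hasSum_orbitSeries hb hψb w⟩⟩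
  · rw [WickBF.U_fn, hψb]
    exact WickBF.hasSum_bfRepTerm_heisFun hb.entire g z
  · rw [WickBF.orbitSeries_fn, hψb]
    rfl
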